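/- Let $\mathbb{P}=\{1,2,\dots\}$, $[k]=\{1,\dots,k\}$ for $k\ge 1$, and let $A$ be $\mathbb{P}$ or $[k]$. For a word $w=w_1\cdots w_n$ over $\mathbb P$ let $\mathrm{des}(w)=|\{i: w_i>w_{i+1}\}|$, $\overline z^{\,w}=z_{w_1}\cdots z_{w_n}$, and let $\mathrm{red}(w)$ be the word obtained by replacing every occurrence of the $i$-th smallest letter of $w$ by $i$. For $u=u_1\cdots u_j$ with $\mathrm{red}(u)=u$, a $u$-match in $w$ is a (consecutive) factor $v$ of $w$ with $\mathrm{red}(v)=u$, and an exact $u$-match is a factor $v=u$. Let $$\mathcal N^{(A)}_u = 1+\sum_{n\ge1}t^n\sum_{w} x^{\mathrm{des}(w)+1}\overline z^{\,w},\qquad \mathcal{EN}^{(A)}_u = 1+\sum_{n\ge1}t^n\sum_{w} x^{\mathrm{des}(w)+1}\overline z^{\,w},$$ where the inner sums run over the words $w$ of length $n$ over $A$ with no $u$-match, respectively with no exact $u$-match. These, and all expressions below, are formal power series in $t$ and the $z_i$ with coefficients in $\mathbb Z[x]$. Let $St^{(A)}(u)$ be the set of $1<s\le j$ such that there is a word $w_1\cdots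 w_{s+j-1}$ over $A$ with $\mathrm{red}(w_1\cdots w_j)=u$ and $\mathrm{red}(w_s\cdots w_{s+j-1})=u$. The word $u$ has the $A$-weakly increasing overlapping property if $u_1\le u_s$ for all $s\in St^{(A)}(u)$. A word $w=w_1\cdots w_n$ is a linked sequence of $u$-matches if it starts with a $u$-match, ends with a $u$-match, and any two consecutive $u$-matches in $w$ share at least two letters. For $a,b\in A$ with $a<b$ let $$wt_{u,A}(ab) = 1-x+\sum_{w}(-x)^{m(w)}\,z_{w_2}\cdots z_{w_{n-1}}\,t^{\,n-2},$$ the sum over all linked sequences $w=w_1\cdots w_n$ of $u$-matches over $A$ with $w_1=a$ and $w_n=b$, where $m(w)$ is the number of $u$-matches in $w$. Define $ewt_{u,A}(ab)$ in the same way with exact $u$-matches in place of $u$-matches. For a finite nonempty set $S=\{j_1<\cdots<j_r\}\subseteq A$ let $$RXTZ_{u,A}(S)=\left(\prod_{i=1}^{r}\frac{z_{j_i}}{1-(1-x)z_{j_i}t}\right)\prod_{i=1}^{r-1}wt_{u,A}(j_ij_{i+1}),$$ and let $ERXTZ_{u,A}(S)$ be the same expression with $ewt_{u,A}$ in place of $wt_{u,A}$.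 **Theorem.** Let $u=u_1\cdots u_j$ be a nonempty word over $\mathbb P$ with $\mathrm{red}(u)=u$, $\mathrm{des}(u)=1$ and $u_1<u_j$. 1. If $u$ has the $\mathbb P$-weakly increasing overlapping property, then $$\mathcal N^{(\mathbb P)}_u=\frac1{1-x\sum_{n\ge1}t^n\sum_{S\subseteq\mathbb P,\,|S|=n}RXTZ_{u,\mathbb P}(S)},\qquad \mathcal{EN}^{(\mathbb P)}_u=\frac1{1-x\sum_{n\ge1}t^n\sum_{S\subseteq\mathbb P,\,|S|=n}ERXTZ_{u,\mathbb P}(S)}.$$ 2. For every $k\ge1$, if $u$ is a word over $[k]$ and has the $[k]$-weakly increasing overlapping property, then $$\mathcal N^{(k)}_u=\frac1{1-x\sum_{n=1}^kt^n\sum_{S\subseteq[k],\,|S|=n}RXTZ_{u,[k]}(S)},\qquad \mathcal{EN}^{(k)}_u=\frac1{1-x\sum_{n=1}^kt^n\sum_{S\subseteq[k],\,|S|=n}ERXTZ_{u,[k]}(S)},$$ where $\mathcal N^{(k)}_u=\mathcal N^{([k])}_u$ and $\mathcal{EN}^{(k)}_u=\mathcal{EN}^{([k])}_u$. -/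

import Mathlib

namespace WordMatch

noncomputable section

open Classical in
/-- `red w`: every occurrence of the `i`-th smallest letter of `w` is replaced by `i`
(a letter `a` is the `i`-th smallest one when `i - 1` distinct letters of `w` are below it). -/
def red (w : List ℕ+) : List ℕ+ :=
  w.map fun a => Nat.succPNat (w.toFinset.filter fun b => b < a).card

/-- The number of descents `w_i > w_{i+1}` of `w`. -/
def des (w : List ℕ+) : ℕ :=
  (w.zip w.tail).countP fun p => decide (p.2 < p.1)

/-- `w` is a word over the alphabet `A`. The alphabet `ℙ` is `Set.univ`, and `[k]` is
`Set.Iic k`. -/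
def IsWordOver (A : Set ℕ+) (w : List ℕ+) : Prop := ∀ a ∈ w, a ∈ A

/-- `v` is a `u`-match (for a reduced word `u`). -/
def IsMatch (u v : List ℕ+) : Prop := red v = u

/-- `v` is an exact `u`-match. -/
def IsExactMatch (u v : List ℕ+) : Prop := v = u

/-! Below, `M` is one of the two relations `IsMatch`, `IsExactMatch`. -/

open Classical in
/-- The (0-based) starting positions of the factors of `w` that are matches of `u`. -/
def matchPositions (M : List ℕ+ → List ℕ+ → Prop) (u w : List ℕ+) : Finset ℕ :=
  (Finset.range w.length).filter fun p => M u ((w.drop p).take u.length)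

/-- The number of matches of `u` in `w`. -/
def mch (M : List ℕ+ → List ℕ+ → Prop) (u w : List ℕ+) : ℕ := (matchPositions M u w).card

/-- The set `St^{(A)}(u)` of (1-based) positions `1 < s ≤ |u|` at which a second `u`-match can
start in a word `w_1 ⋯ w_{s+|u|-1}` over `A` that starts with a `u`-match. -/
def St (A : Set ℕ+) (u : List ℕ+) : Set ℕ :=
  {s | 1 < s ∧ s ≤ u.length ∧ ∃ w : List ℕ+, IsWordOver A w ∧ w.length = s + u.length - 1 ∧
    red (w.take u.length) = u ∧ red (w.drop (s - 1)) = u}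

/-- The `A`-weakly increasing overlapping property: `s ∈ St^{(A)}(u)` implies `u_1 ≤ u_s`. -/
def WeaklyIncreasingOverlap (A : Set ℕ+) (u : List ℕ+) : Prop :=
  ∀ s ∈ St A u, ∀ a ∈ u[0]?, ∀ b ∈ u[s - 1]?, a ≤ b

/-- `w` is a linked sequence of matches of `u`: it starts with a match, it ends with a match, and
any two consecutive matches in it share at least two letters. -/
def IsLinked (M : List ℕ+ → List ℕ+ → Prop) (u w : List ℕ+) : Prop :=
  0 ∈ matchPositions M u w ∧
  (∃ p ∈ matchPositions M u w, p + u.length = w.length) ∧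
  ∀ p ∈ matchPositions M u w, ∀ q ∈ matchPositions M u w, p < q →
    (∀ r ∈ matchPositions M u w, ¬ (p < r ∧ r < q)) → q + 2 ≤ p + u.length

/-! ### Formal power series -/

/-- Power series in `z_1, z_2, …` with coefficients in `ℤ[x]`. -/
abbrev ZSeries := MvPowerSeries ℕ+ (Polynomial ℤ)

/-- Power series in `t` with coefficients in `ℤ[x][[z_1, z_2, …]]`. -/
abbrev TSeries := PowerSeries ZSeries

/-- The variable `x`. -/
def x : ZSeries := MvPowerSeries.C Polynomial.X

/-- The variable `z_i`. -/
def z (i : ℕ+) : ZSeries := MvPowerSeries.X i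

/-- The monomial `z_{w_1} ⋯ z_{w_n}`. -/
def zWord (w : List ℕ+) : ZSeries := (w.map z).prod

/-- The variable `t`. -/
def t : TSeries := PowerSeries.X

/-- A series in `z` and `x`, viewed as a series in `t`. -/
def toT (f : ZSeries) : TSeries := PowerSeries.C f

/-- The family `f` can be summed: every monomial occurs in only finitely many members. -/
def ZSummable {ι : Type} (f : ι → ZSeries) : Prop :=
  ∀ d : ℕ+ →₀ ℕ, {i | MvPowerSeries.coeff d (f i) ≠ 0}.Finite

/-- The coefficientwise sum of a family. -/
def zSum {ι : Type} (f : ι → ZSeries) : ZSeries :=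
  fun d => ∑ᶠ i, MvPowerSeries.coeff d (f i)

/-- The family `f` can be summed: every monomial occurs in only finitely many members. -/
def TSummable {ι : Type} (f : ι → TSeries) : Prop :=
  ∀ n : ℕ, ZSummable fun i => PowerSeries.coeff n (f i)

/-- The coefficientwise sum of a family. -/
def tSum {ι : Type} (f : ι → TSeries) : TSeries :=
  PowerSeries.mk fun n => zSum fun i => PowerSeries.coeff n (f i)

/-- `1 / f`, for a series `f` in `t` with constant term `1`; see `mul_recip`. -/
def recip (f : TSeries) : TSeries := PowerSeries.invOfUnit f 1

theorem mul_recip (f : TSeries) (h : PowerSeries.constantCoeff f = 1) : f * recip f = 1 :=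
  PowerSeries.mul_invOfUnit f 1 (by simpa using h)

/-! ### The generating functions -/

/-- The term of a word in the generating functions. -/
def wordTerm (w : List ℕ+) : ZSeries := x ^ (des w + 1) * zWord w

/-- `∑ x^{des w + 1} z^w` over the words `w` over `A` of length `n` without a match of `u`. -/
def avoidCoeff (A : Set ℕ+) (M : List ℕ+ → List ℕ+ → Prop) (u : List ℕ+) (n : ℕ) : ZSeries :=
  zSum fun w : {w : List ℕ+ // w.length = n ∧ IsWordOver A w ∧ mch M u w = 0} => wordTerm w.1

/-- `1 + ∑_{n ≥ 1} t^n ∑ x^{des w + 1} z^w`, over the words without a match of `u`. -/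
def avoidGF (A : Set ℕ+) (M : List ℕ+ → List ℕ+ → Prop) (u : List ℕ+) : TSeries :=
  PowerSeries.mk fun n => if n = 0 then 1 else avoidCoeff A M u n

/-- The weight of the letters `v` between the end points of a linked sequence `i v j`: a factor
`-x` for every match in the sequence, and `z_a t` for every letter `a` of `v`. -/
def linkTerm (M : List ℕ+ → List ℕ+ → Prop) (u : List ℕ+) (i j : ℕ+) (v : List ℕ+) : TSeries :=
  toT ((-x) ^ mch M u (i :: (v ++ [j])) * zWord v) * t ^ v.length

/-- The weight `wt_u(ij)` (`ewt_u(ij)` for exact matches) of a rise `ij` over the alphabet `A`: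
`1 - x`, plus the weights of all the linked sequences over `A` that start with `i` and end
with `j`. -/
def wt (A : Set ℕ+) (M : List ℕ+ → List ℕ+ → Prop) (u : List ℕ+) (i j : ℕ+) : TSeries :=
  1 - toT x +
    tSum fun v : {v : List ℕ+ // IsWordOver A (i :: (v ++ [j])) ∧
      IsLinked M u (i :: (v ++ [j]))} => linkTerm M u i j v.1

/-- `RXTZ_u(S)` (`ERXTZ_u(S)` for exact matches): for `S = {j_1 < ⋯ < j_k}`, the product of
`z_{j_i} / (1 - (1 - x) z_{j_i} t)` over `i = 1, …, k` and of `wt_u(j_i j_{i+1})` over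
`i = 1, …, k - 1`. -/
def RXTZ (A : Set ℕ+) (M : List ℕ+ → List ℕ+ → Prop) (u : List ℕ+) (S : Finset ℕ+) : TSeries :=
  (∏ a ∈ S, toT (z a) * recip (1 - toT ((1 - x) * z a) * t)) *
    (((S.sort (· ≤ ·)).zip (S.sort (· ≤ ·)).tail).map fun p => wt A M u p.1 p.2).prod

/-- `∑ RXTZ_u(S)` over the `n`-element sets `S` of positive integers. -/
def RXTZSum (M : List ℕ+ → List ℕ+ → Prop) (u : List ℕ+) (n : ℕ) : TSeries :=
  tSum fun S : {S : Finset ℕ+ // S.card = n} => RXTZ Set.univ M u S.1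

/-- The denominator `1 - x ∑_{n ≥ 1} t^n ∑_{|S| = n} RXTZ_u(S)`, `S ⊆ ℙ`. -/
def denomPP (M : List ℕ+ → List ℕ+ → Prop) (u : List ℕ+) : TSeries :=
  1 - toT x * tSum fun n : {n : ℕ // 1 ≤ n} => t ^ n.1 * RXTZSum M u n.1

/-- The denominator `1 - x ∑_{n = 1}^k t^n ∑_{|S| = n} RXTZ_u(S)`, `S ⊆ [k]`. -/
def denomK (k : ℕ+) (M : List ℕ+ → List ℕ+ → Prop) (u : List ℕ+) : TSeries :=
  1 - toT x * ∑ n ∈ Finset.Icc 1 (k : ℕ),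
    t ^ n * ∑ S ∈ Finset.powersetCard n (Finset.Icc 1 k), RXTZ (Set.Iic k) M u S

/-! ### All the sums and reciprocals above make sense -/

theorem zWord_eq (w : List ℕ+) :
    zWord w = MvPowerSeries.monomial (Multiset.toFinsupp (w : Multiset ℕ+)) 1 := by
  induction w with
  | nil => simp [zWord]
  | cons a w ih =>
    have h1 : zWord (a :: w) = z a * zWord w := by simp [zWord]
    rw [h1, ih, z, MvPowerSeries.X, MvPowerSeries.monomial_mul_monomial, ← Multiset.cons_coe,
      ← Multiset.singleton_add, map_add, Multiset.toFinsupp_singleton, one_mul]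

theorem finite_coeff_zWord (c : List ℕ+ → ZSeries) (hc : ∀ w, ∃ p : Polynomial ℤ,
    c w = MvPowerSeries.C p) (d : ℕ+ →₀ ℕ) :
    {w : List ℕ+ | MvPowerSeries.coeff d (c w * zWord w) ≠ 0}.Finite := by
  classical
  refine ((Finsupp.toMultiset d).lists.finite_toSet).subset ?_
  intro w hw
  obtain ⟨p, hp⟩ := hc w
  have h : d = Multiset.toFinsupp (w : Multiset ℕ+) := by
    by_contra hne
    apply hw
    rw [hp, MvPowerSeries.coeff_C_mul, zWord_eq, MvPowerSeries.coeff_monomial_ne hne, mul_zero]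
  change w ∈ (Finsupp.toMultiset d).lists
  rw [Multiset.mem_lists_iff, h]
  simp

theorem wordTerm_summable (A : Set ℕ+) (M : List ℕ+ → List ℕ+ → Prop) (u : List ℕ+) (n : ℕ) :
    ZSummable fun w : {w : List ℕ+ // w.length = n ∧ IsWordOver A w ∧ mch M u w = 0} =>
      wordTerm w.1 := fun d =>
  (finite_coeff_zWord (fun w => x ^ (des w + 1))
    (fun w => ⟨Polynomial.X ^ (des w + 1), by simp [x]⟩) d).preimage
    Subtype.val_injective.injOn

theorem linkTerm_summable (A : Set ℕ+) (M : List ℕ+ → List ℕ+ → Prop) (u : List ℕ+) (i j : ℕ+) :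
    TSummable fun v : {v : List ℕ+ // IsWordOver A (i :: (v ++ [j])) ∧
      IsLinked M u (i :: (v ++ [j]))} => linkTerm M u i j v.1 := by
  intro n d
  refine ((finite_coeff_zWord (fun v => (-x) ^ mch M u (i :: (v ++ [j])))
    (fun v => ⟨(-Polynomial.X) ^ mch M u (i :: (v ++ [j])), by simp [x]⟩) d).preimage
    Subtype.val_injective.injOn).subset ?_
  intro v hv h0
  apply hv
  simp only [linkTerm, toT, t, PowerSeries.coeff_C_mul, PowerSeries.coeff_X_pow]
  split_ifs
  · rw [mul_one]; exact h0
  · simp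

theorem recip_denom (a : ℕ+) :
    (1 - toT ((1 - x) * z a) * t) * recip (1 - toT ((1 - x) * z a) * t) = 1 :=
  mul_recip _ (by simp [t])

theorem RXTZ_summable (M : List ℕ+ → List ℕ+ → Prop) (u : List ℕ+) (n : ℕ) :
    TSummable fun S : {S : Finset ℕ+ // S.card = n} => RXTZ Set.univ M u S.1 := by
  classical
  intro m d
  refine (((d.support.powerset : Finset (Finset ℕ+)).finite_toSet).preimage
    Subtype.val_injective.injOn).subset ?_
  intro S hS
  simp only [Set.mem_preimage, Finset.coe_powerset]
  intro a ha
  by_contra hna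
  apply hS
  have hdvd : toT (z a) ∣ RXTZ Set.univ M u S.1 :=
    (Dvd.intro _ rfl : toT (z a) ∣ toT (z a) * recip (1 - toT ((1 - x) * z a) * t)).trans
      ((Finset.dvd_prod_of_mem
        (fun a => toT (z a) * recip (1 - toT ((1 - x) * z a) * t)) ha).trans (Dvd.intro _ rfl))
  obtain ⟨r, hr⟩ := hdvd
  have h0 : d a = 0 := by simpa using hna
  change MvPowerSeries.coeff d (PowerSeries.coeff m (RXTZ Set.univ M u S.1)) = 0
  rw [hr, toT, PowerSeries.coeff_C_mul, z]
  exact MvPowerSeries.X_dvd_iff.mp (Dvd.intro _ rfl) d h0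

theorem RXTZSum_summable (M : List ℕ+ → List ℕ+ → Prop) (u : List ℕ+) :
    TSummable fun n : {n : ℕ // 1 ≤ n} => t ^ n.1 * RXTZSum M u n.1 := by
  intro m d
  refine ((Set.finite_Iic m).preimage Subtype.val_injective.injOn).subset ?_
  intro n hn
  by_contra hlt
  apply hn
  simp only [Set.mem_preimage, Set.mem_Iic] at hlt
  simp [t, PowerSeries.coeff_X_pow_mul', hlt]

end

end WordMatch

/-! ### Functions on words under concatenation, and their generating series -/

namespace WordMatch

noncomputable section

/-! The identity already holds with noncommuting letters, word by word. Functions from words to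
`ℤ[x]` form a ring under `conv`, and `wordSeries` carries products to products (`wordSeries_mul`).
In this ring `t ^ |S| * RXTZ S` comes from blocks: a run of the smallest letter of `S`, a link to
the next letter, a run of that letter, and so on. The theorem then reads `F = 1 + x * B * F`, with
`F` the weight of the avoiding words and `B` the sum of all block weights (`avoidWt_eq`).

Expanding only the first letter `a` of a block gives three cases: the block ends, its run continues
with factor `1 - x`, or a link leads to a larger letter `b`. In the last case the new block starting
at `b` is summed by induction on length (`sum_conv_blockWt`). What remains is a recursion for `F (a
:: w)` (`avoidWt_cons`). At a weak rise the factor `1 - x` corrects `x * F w` to `F w`. The matches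
that may start at `a` are accounted for by the linked prefixes (`sum_isLinked_take`).

That last sum is a sign cancellation. A match has exactly one descent, and the matches of a linked
sequence cover all its adjacent pairs, so every term carries the same power of `x`
(`des_eq_of_linked`). The single descent also prevents three matches from crowding together
(`matchPositions_gap`). Hence only linked prefixes ending at the last or the last but one match can
leave a match-free remainder, and these two have opposite signs (`sum_linked`).

The overlap hypothesis and `u_1 < u_j` enter once: they make the first letter of a linked sequence
smaller than its last (`letter_lt_of_isLinked`), so listing the letters of a block in increasing
order loses no linked prefix. -/

/-- The Cauchy product of two functions on words. -/
def conv (f g : List ℕ+ → Polynomial ℤ) (w : List ℕ+) : Polynomial ℤ :=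
  ∑ i ∈ Finset.range (w.length + 1), f (w.take i) * g (w.drop i)

/-- The indicator function of the empty word. -/
def convOne (w : List ℕ+) : Polynomial ℤ := if w = [] then 1 else 0

theorem conv_nil (f g : List ℕ+ → Polynomial ℤ) : conv f g [] = f [] * g [] := by
  simp [conv]

theorem conv_cons (f g : List ℕ+ → Polynomial ℤ) (a : ℕ+) (w : List ℕ+) :
    conv f g (a :: w) = f [] * g (a :: w) + conv (fun v => f (a :: v)) g w := by
  simp only [conv, List.length_cons]
  rw [Finset.sum_range_succ', add_comm]
  simp

theorem conv_add_left (f f' g : List ℕ+ → Polynomial ℤ) (w : List ℕ+) :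
    conv (fun v => f v + f' v) g w = conv f g w + conv f' g w := by
  simp [conv, add_mul, Finset.sum_add_distrib]

theorem conv_mul_left (c : Polynomial ℤ) (f g : List ℕ+ → Polynomial ℤ) (w : List ℕ+) :
    conv (fun v => c * f v) g w = c * conv f g w := by
  simp [conv, mul_assoc, Finset.mul_sum]

theorem conv_zero_left (g : List ℕ+ → Polynomial ℤ) (w : List ℕ+) :
    conv (fun _ => 0) g w = 0 := by
  simp [conv]

theorem conv_one_left (g : List ℕ+ → Polynomial ℤ) (w : List ℕ+) :
    conv convOne g w = g w := by
  cases w with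
  | nil => simp [conv_nil, convOne]
  | cons a w => simp [conv_cons, convOne, conv_zero_left]

theorem conv_assoc (f g h : List ℕ+ → Polynomial ℤ) (w : List ℕ+) :
    conv (conv f g) h w = conv f (conv g h) w := by
  induction w generalizing f with
  | nil => simp [conv_nil, mul_assoc]
  | cons a w ih =>
    rw [conv_cons, conv_cons f, ← ih, conv_nil, conv_cons g]
    simp only [conv_cons f g]
    rw [conv_add_left, conv_mul_left]
    ring

theorem conv_ne_zero {f g : List ℕ+ → Polynomial ℤ} {w : List ℕ+} (h : conv f g w ≠ 0) :
    ∃ v v', v ++ v' = w ∧ f v ≠ 0 ∧ g v' ≠ 0 := by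
  obtain ⟨i, -, hi⟩ := Finset.exists_ne_zero_of_sum_ne_zero h
  exact ⟨_, _, List.take_append_drop i w, left_ne_zero_of_mul hi, right_ne_zero_of_mul hi⟩

/-- The words whose multiset of letters is `d`. -/
def wordsOf (d : ℕ+ →₀ ℕ) : Finset (List ℕ+) :=
  open Classical in (Finsupp.toMultiset d).lists.toFinset

theorem mem_wordsOf (w : List ℕ+) (d : ℕ+ →₀ ℕ) :
    w ∈ wordsOf d ↔ d = Multiset.toFinsupp (w : Multiset ℕ+) := by
  classical
  rw [wordsOf, Multiset.mem_toFinset, Multiset.mem_lists_iff]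
  constructor
  · intro h
    rw [← show Finsupp.toMultiset d = (w : Multiset ℕ+) from h]
    simp
  · rintro rfl
    simp

/-- The power series with the given coefficients. -/
def ofCoeff (g : (ℕ+ →₀ ℕ) → Polynomial ℤ) : ZSeries := g

theorem coeff_ofCoeff (g : (ℕ+ →₀ ℕ) → Polynomial ℤ) (d : ℕ+ →₀ ℕ) :
    MvPowerSeries.coeff d (ofCoeff g) = g d := rfl

/-- The series `∑ f(w) z^w t^{|w|}` over all words `w`. -/
def wordSeries (f : List ℕ+ → Polynomial ℤ) : TSeries :=
  PowerSeries.mk fun n => ofCoeff fun d =>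
    ∑ w ∈ wordsOf d, if w.length = n then f w else 0

theorem coeff_wordSeries (f : List ℕ+ → Polynomial ℤ) (n : ℕ) (d : ℕ+ →₀ ℕ) :
    MvPowerSeries.coeff d (PowerSeries.coeff n (wordSeries f)) =
      ∑ w ∈ wordsOf d, if w.length = n then f w else 0 := by
  rw [wordSeries, PowerSeries.coeff_mk, coeff_ofCoeff]

theorem tSeries_ext {f g : TSeries} (h : ∀ n d, MvPowerSeries.coeff d (PowerSeries.coeff n f) =
    MvPowerSeries.coeff d (PowerSeries.coeff n g)) : f = g :=
  PowerSeries.ext fun n => MvPowerSeries.ext fun d => h n d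

/-- Choosing a splitting of the content and a word for each part amounts to choosing a word of the
whole content and a place to cut it. This is the combinatorial content of `wordSeries_mul`. -/
theorem sum_antidiagonal_lists (H : List ℕ+ → List ℕ+ → Polynomial ℤ) (d : ℕ+ →₀ ℕ) :
    ∑ q ∈ Finset.HasAntidiagonal.antidiagonal d, ∑ v ∈ wordsOf q.1,
      ∑ v' ∈ wordsOf q.2, H v v' =
    ∑ w ∈ wordsOf d, ∑ i ∈ Finset.range (w.length + 1),
      H (w.take i) (w.drop i) := by
  classical
  simp_rw [← Finset.sum_product']
  rw [Finset.sum_sigma', Finset.sum_sigma']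
  refine Finset.sum_bij'
    (fun p _ => (⟨p.2.1 ++ p.2.2, p.2.1.length⟩ : (_ : List ℕ+) × ℕ))
    (fun p _ => (⟨(Multiset.toFinsupp (p.1.take p.2 : Multiset ℕ+),
        Multiset.toFinsupp (p.1.drop p.2 : Multiset ℕ+)), (p.1.take p.2, p.1.drop p.2)⟩ :
        (_ : (ℕ+ →₀ ℕ) × (ℕ+ →₀ ℕ)) × (List ℕ+ × List ℕ+))) ?_ ?_ ?_ ?_ ?_
  · rintro ⟨⟨d1, d2⟩, ⟨v, v'⟩⟩ h
    simp only [Finset.mem_sigma, Finset.HasAntidiagonal.mem_antidiagonal, Finset.mem_product,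
      mem_wordsOf] at h
    obtain ⟨rfl, rfl, rfl⟩ := h
    simp only [Finset.mem_sigma, mem_wordsOf, Finset.mem_range, List.length_append]
    refine ⟨?_, by omega⟩
    rw [← map_add, Multiset.coe_add]
  · rintro ⟨w, i⟩ h
    simp only [Finset.mem_sigma, mem_wordsOf] at h
    obtain ⟨rfl, -⟩ := h
    simp only [Finset.mem_sigma, Finset.HasAntidiagonal.mem_antidiagonal, Finset.mem_product,
      mem_wordsOf, and_true]
    rw [← map_add, Multiset.coe_add, List.take_append_drop]
  · rintro ⟨⟨d1, d2⟩, ⟨v, v'⟩⟩ h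
    simp only [Finset.mem_sigma, Finset.HasAntidiagonal.mem_antidiagonal, Finset.mem_product,
      mem_wordsOf] at h
    obtain ⟨rfl, rfl, rfl⟩ := h
    simp
  · rintro ⟨w, i⟩ h
    simp only [Finset.mem_sigma, Finset.mem_range] at h
    have : i ≤ w.length := by omega
    simp [this]
  · rintro ⟨⟨d1, d2⟩, ⟨v, v'⟩⟩ h
    simp

theorem wordSeries_mul (f g : List ℕ+ → Polynomial ℤ) :
    wordSeries f * wordSeries g = wordSeries (conv f g) := by
  classical
  refine tSeries_ext fun n d => ?_
  rw [PowerSeries.coeff_mul, map_sum, coeff_wordSeries]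
  simp only [MvPowerSeries.coeff_mul, coeff_wordSeries]
  have h : ∀ p : ℕ × ℕ, ∑ q ∈ Finset.HasAntidiagonal.antidiagonal d,
      (∑ w ∈ wordsOf q.1, if w.length = p.1 then f w else 0) *
        (∑ w ∈ wordsOf q.2, if w.length = p.2 then g w else 0) =
      ∑ w ∈ wordsOf d, ∑ i ∈ Finset.range (w.length + 1),
        (if (w.take i).length = p.1 then f (w.take i) else 0) *
          (if (w.drop i).length = p.2 then g (w.drop i) else 0) := by
    intro p
    rw [← sum_antidiagonal_lists fun v v' => (if v.length = p.1 then f v else 0) *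
      (if v'.length = p.2 then g v' else 0)]
    simp_rw [Finset.sum_mul_sum]
  simp_rw [h]
  rw [Finset.sum_comm]
  refine Finset.sum_congr rfl fun w _ => ?_
  rw [Finset.sum_comm, conv]
  split_ifs with hn
  · refine Finset.sum_congr rfl fun i hi => ?_
    have hi' : i ≤ w.length := by simpa [Nat.lt_succ_iff] using hi
    -- A cut at `i` determines the degrees in `t` of both factors, so only one pair of the
    -- antidiagonal survives.
    rw [Finset.sum_eq_single (i, w.length - i)]
    · simp [hi']
    · rintro ⟨b, c⟩ - hne
      split_ifs with h1 h2
      · exfalso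
        apply hne
        simp only [List.length_take, List.length_drop, min_eq_left hi'] at h1 h2
        rw [← h1, ← h2]
      all_goals simp
    · intro hmem
      exfalso
      apply hmem
      simp only [Finset.HasAntidiagonal.mem_antidiagonal]
      omega
  · refine Finset.sum_eq_zero fun i hi => Finset.sum_eq_zero fun p hp => ?_
    have hi' : i ≤ w.length := by simpa [Nat.lt_succ_iff] using hi
    rw [Finset.HasAntidiagonal.mem_antidiagonal] at hp
    split_ifs with h1 h2
    · simp only [List.length_take, List.length_drop, min_eq_left hi'] at h1 h2
      omega
    all_goals simp

theorem wordSeries_add (f g : List ℕ+ → Polynomial ℤ) :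
    wordSeries (fun w => f w + g w) = wordSeries f + wordSeries g := by
  refine tSeries_ext fun n d => ?_
  simp only [map_add, coeff_wordSeries, ← Finset.sum_add_distrib]
  refine Finset.sum_congr rfl fun w _ => ?_
  split_ifs <;> simp

theorem wordSeries_const_mul (c : Polynomial ℤ) (f : List ℕ+ → Polynomial ℤ) :
    wordSeries (fun w => c * f w) = toT (MvPowerSeries.C c) * wordSeries f := by
  refine tSeries_ext fun n d => ?_
  rw [toT, PowerSeries.coeff_C_mul, MvPowerSeries.coeff_C_mul]
  simp only [coeff_wordSeries, Finset.mul_sum, mul_ite, mul_zero]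

theorem wordSeries_sum {ι : Type} (s : Finset ι) (f : ι → List ℕ+ → Polynomial ℤ) :
    wordSeries (fun w => ∑ i ∈ s, f i w) = ∑ i ∈ s, wordSeries (f i) := by
  classical
  refine tSeries_ext fun n d => ?_
  simp only [map_sum, coeff_wordSeries]
  rw [Finset.sum_comm]
  refine Finset.sum_congr rfl fun w _ => ?_
  split_ifs <;> simp

theorem coeff_zWord (d : ℕ+ →₀ ℕ) (w : List ℕ+) :
    MvPowerSeries.coeff d (zWord w) = if w ∈ wordsOf d then 1 else 0 := by
  classical
  rw [zWord_eq, MvPowerSeries.coeff_monomial]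
  simp only [mem_wordsOf]

theorem finsum_subtype_eq_sum {ι N : Type*} [AddCommMonoid N] (p : ι → Prop) [DecidablePred p]
    (f : ι → N) (s : Finset ι) (h : ∀ i, p i → f i ≠ 0 → i ∈ s) :
    ∑ᶠ i : {i // p i}, f i = ∑ i ∈ s with p i, f i := by
  rw [← Finset.sum_subtype_eq_sum_filter]
  refine finsum_eq_sum_of_support_subset _ fun i hi => ?_
  simpa using h i.1 i.2 hi

theorem zSum_zWord (p : List ℕ+ → Prop) (c : List ℕ+ → Polynomial ℤ) (d : ℕ+ →₀ ℕ) :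
    MvPowerSeries.coeff d (zSum fun w : {w : List ℕ+ // p w} =>
      MvPowerSeries.C (c w.1) * zWord w.1) =
    ∑ w ∈ wordsOf d, open Classical in if p w then c w else 0 := by
  classical
  change ∑ᶠ w : {w : List ℕ+ // p w}, MvPowerSeries.coeff d
    (MvPowerSeries.C (c w.1) * zWord w.1) = _
  simp only [MvPowerSeries.coeff_C_mul, coeff_zWord, mul_ite, mul_one, mul_zero]
  rw [finsum_subtype_eq_sum p (fun w => if w ∈ wordsOf d then c w else 0) (wordsOf d)
    (by simp +contextual), Finset.sum_filter]
  exact Finset.sum_congr rfl fun w hw => by simp [hw]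

theorem tSum_zWord (p : List ℕ+ → Prop) (c : List ℕ+ → Polynomial ℤ) :
    (tSum fun w : {w : List ℕ+ // p w} =>
      toT (MvPowerSeries.C (c w.1) * zWord w.1) * t ^ w.1.length) =
    wordSeries fun w => open Classical in if p w then c w else 0 := by
  classical
  refine tSeries_ext fun n d => ?_
  rw [tSum, PowerSeries.coeff_mk, coeff_wordSeries]
  have h := zSum_zWord p (fun w => if w.length = n then c w else 0) d
  refine Eq.trans (congrArg _ (congrArg zSum (funext fun w => ?_))) (h.trans ?_)
  · rw [toT, PowerSeries.coeff_C_mul, t, PowerSeries.coeff_X_pow]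
    simp only [eq_comm (a := n)]
    split_ifs <;> simp
  · refine Finset.sum_congr rfl fun w _ => ?_
    split_ifs <;> rfl

theorem wordSeries_convOne : wordSeries convOne = 1 := by
  classical
  refine tSeries_ext fun n d => ?_
  rw [coeff_wordSeries, PowerSeries.coeff_one]
  simp only [convOne]
  by_cases hd : d = 0
  · subst hd
    have : wordsOf (0 : ℕ+ →₀ ℕ) = {[]} := by
      ext w
      simp only [mem_wordsOf, Finset.mem_singleton]
      rw [eq_comm, EmbeddingLike.map_eq_zero_iff, Multiset.coe_eq_zero]
    rw [this]
    by_cases hn : n = 0 <;> simp [hn, eq_comm (a := 0)]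
  · rw [Finset.sum_eq_zero]
    · split_ifs <;> simp [MvPowerSeries.coeff_one, hd]
    · intro w hw
      have : w ≠ [] := by
        rintro rfl
        exact hd (by simpa [mem_wordsOf] using hw)
      simp [this]

end

end WordMatch

/-! ### Runs, links and blocks; the denominators as word series -/

namespace WordMatch

noncomputable section

/-- The indicator function of the one-letter word `a`. -/
def letterWt (a : ℕ+) (w : List ℕ+) : Polynomial ℤ := if w = [a] then 1 else 0

theorem conv_letterWt_nil (a : ℕ+) (g : List ℕ+ → Polynomial ℤ) :
    conv (letterWt a) g [] = 0 := by
  simp [conv_nil, letterWt]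

theorem conv_letterWt_cons (a b : ℕ+) (g : List ℕ+ → Polynomial ℤ) (w : List ℕ+) :
    conv (letterWt a) g (b :: w) = if b = a then g w else 0 := by
  rw [conv_cons]
  by_cases h : b = a
  · have : (fun v => letterWt a (b :: v)) = convOne := by
      funext v
      simp [letterWt, convOne, h]
    rw [this, conv_one_left]
    simp [letterWt, h]
  · have : (fun v => letterWt a (b :: v)) = fun _ => 0 := by
      funext v
      simp [letterWt, h]
    rw [this, conv_zero_left]
    simp [letterWt, h]

theorem wordSeries_letterWt (a : ℕ+) : wordSeries (letterWt a) = toT (z a) * t := by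
  classical
  refine tSeries_ext fun n d => ?_
  rw [coeff_wordSeries, toT, PowerSeries.coeff_C_mul, t, PowerSeries.coeff_X]
  have h : ∀ w : List ℕ+, (if w.length = n then letterWt a w else 0) =
      if w = [a] then (if n = 1 then 1 else 0) else 0 := by
    intro w
    by_cases h1 : w = [a]
    · simp [letterWt, h1, eq_comm]
    · simp [letterWt, h1]
  simp only [h, Finset.sum_ite_eq']
  have h2 : z a = zWord [a] := by simp [zWord]
  by_cases hn : n = 1
  · simp [hn, h2, coeff_zWord]
  · simp [hn]

/-- The weight `(1 - x)^{k - 1}` of the words `a^k`, `k ≥ 1`. -/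
def runWt (a : ℕ+) : List ℕ+ → Polynomial ℤ
  | [] => 0
  | b :: w => if b = a then convOne w + (1 - Polynomial.X) * runWt a w else 0

theorem runWt_eq_conv (a : ℕ+) :
    runWt a = conv (letterWt a) fun w => convOne w + (1 - Polynomial.X) * runWt a w := by
  funext w
  cases w with
  | nil => rw [conv_letterWt_nil, runWt]
  | cons b w => rw [conv_letterWt_cons, runWt]

theorem conv_runWt_cons (a b : ℕ+) (g : List ℕ+ → Polynomial ℤ) (w : List ℕ+) :
    conv (runWt a) g (b :: w) =
      if b = a then g w + (1 - Polynomial.X) * conv (runWt a) g w else 0 := by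
  conv_lhs => rw [runWt_eq_conv]
  rw [conv_assoc, conv_letterWt_cons, conv_add_left, conv_one_left, conv_mul_left]

theorem runWt_ne_zero {a : ℕ+} {w : List ℕ+} (h : runWt a w ≠ 0) :
    w.head? = some a ∧ ∀ b ∈ w, b = a := by
  induction w with
  | nil => simp [runWt] at h
  | cons b w ih =>
    rw [runWt] at h
    split_ifs at h with hb
    · refine ⟨by simp [hb], ?_⟩
      by_cases hw : w = []
      · simp [hw, hb]
      · simp only [convOne, hw, if_false, zero_add] at h
        simpa [hb] using (ih (right_ne_zero_of_mul h)).2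
    · exact absurd rfl h

/-- A run is the letter `a`, followed by nothing or by `1 - x` times another run. Solving this
linear equation for the series produces the geometric factor. -/
theorem wordSeries_runWt (a : ℕ+) :
    wordSeries (runWt a) = toT (z a) * recip (1 - toT ((1 - x) * z a) * t) * t := by
  have h := congrArg wordSeries (runWt_eq_conv a)
  rw [← wordSeries_mul, wordSeries_add, wordSeries_const_mul, wordSeries_convOne,
    wordSeries_letterWt] at h
  have hx : toT (MvPowerSeries.C (1 - Polynomial.X : Polynomial ℤ)) = toT (1 - x) := by
    simp [x]
  rw [hx] at h
  have h1 : toT ((1 - x) * z a) = toT (1 - x) * toT (z a) := by simp [toT]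
  have h2 := recip_denom a
  calc wordSeries (runWt a)
      = wordSeries (runWt a) * ((1 - toT ((1 - x) * z a) * t) *
          recip (1 - toT ((1 - x) * z a) * t)) := by rw [h2, mul_one]
    _ = (wordSeries (runWt a) - toT (1 - x) * toT (z a) * t * wordSeries (runWt a)) *
          recip (1 - toT ((1 - x) * z a) * t) := by rw [h1]; ring
    _ = toT (z a) * t * recip (1 - toT ((1 - x) * z a) * t) := by
          congr 1
          linear_combination h
    _ = _ := by ring

variable (A : Set ℕ+) (M : List ℕ+ → List ℕ+ → Prop) (u : List ℕ+)

open Classical in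
/-- The coefficients of `wt A M u a b`. -/
def linkWt (a b : ℕ+) (v : List ℕ+) : Polynomial ℤ :=
  (1 - Polynomial.X) * convOne v +
    if IsWordOver A (a :: (v ++ [b])) ∧ IsLinked M u (a :: (v ++ [b])) then
      (-Polynomial.X) ^ mch M u (a :: (v ++ [b])) else 0

theorem wordSeries_linkWt (a b : ℕ+) : wordSeries (linkWt A M u a b) = wt A M u a b := by
  classical
  have h := tSum_zWord (fun v => IsWordOver A (a :: (v ++ [b])) ∧ IsLinked M u (a :: (v ++ [b])))
    (fun v => (-Polynomial.X) ^ mch M u (a :: (v ++ [b])))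
  unfold linkWt
  rw [wordSeries_add, wordSeries_const_mul, wordSeries_convOne, wt]
  congr 1
  · simp [x, toT]
  · refine Eq.trans ?_ (h.symm.trans ?_)
    · congr!
    · simp [x, linkTerm]

/-- The coefficients of `t ^ |S| * RXTZ A M u S`, for `S` listed in increasing order. -/
def blockWt : List ℕ+ → List ℕ+ → Polynomial ℤ
  | [] => fun _ => 0
  | [a] => runWt a
  | a :: b :: L => conv (runWt a) (conv (linkWt A M u a b) (blockWt (b :: L)))

theorem wordSeries_blockWt (L : List ℕ+) (hL : L ≠ []) :
    wordSeries (blockWt A M u L) =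
      t ^ L.length * ((L.map fun a => toT (z a) * recip (1 - toT ((1 - x) * z a) * t)).prod *
        ((L.zip L.tail).map fun p => wt A M u p.1 p.2).prod) := by
  induction L with
  | nil => exact absurd rfl hL
  | cons a L ih =>
    cases L with
    | nil => simp [blockWt, wordSeries_runWt, mul_comm]
    | cons b L =>
      rw [blockWt, ← wordSeries_mul, ← wordSeries_mul, ih (by simp), wordSeries_runWt,
        wordSeries_linkWt]
      simp only [List.length_cons, List.map_cons, List.prod_cons, List.tail_cons,
        List.zip_cons_cons, pow_succ]
      ring

theorem wordSeries_blockWt_sort (S : Finset ℕ+) (hS : S.Nonempty) :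
    wordSeries (blockWt A M u (S.sort (· ≤ ·))) = t ^ S.card * RXTZ A M u S := by
  have h : S.sort (· ≤ ·) ≠ [] := by
    intro h
    have := congrArg List.length h
    rw [Finset.length_sort] at this
    exact hS.card_ne_zero this
  rw [wordSeries_blockWt A M u _ h, Finset.length_sort, RXTZ]
  congr 2
  rw [← Finset.prod_map_toList]
  exact ((Finset.sort_perm_toList S (· ≤ ·)).map _).prod_eq

variable {A M u}

/-- The support of a block weight is all that later arguments need. The first letter fixes the
minimum of `S`, and the occurrence of every letter of `S` makes the sums over `S` finite on each
word. -/
theorem blockWt_ne_zero {L w : List ℕ+} (h : blockWt A M u L w ≠ 0) :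
    w.head? = L.head? ∧ (∀ a ∈ L, a ∈ w) ∧ ((∀ a ∈ L, a ∈ A) → IsWordOver A w) := by
  induction L generalizing w with
  | nil => simp [blockWt] at h
  | cons a L ih =>
    cases L with
    | nil =>
      obtain ⟨h1, h2⟩ := runWt_ne_zero h
      refine ⟨h1, ?_, ?_⟩
      · simpa using List.mem_of_mem_head? h1
      · intro h3 b hb
        rw [h2 b hb]
        exact h3 a (by simp)
    | cons b L =>
      obtain ⟨v, v', rfl, hv, hv'⟩ := conv_ne_zero h
      obtain ⟨y, y', rfl, hy, hy'⟩ := conv_ne_zero hv'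
      obtain ⟨h1, h2⟩ := runWt_ne_zero hv
      obtain ⟨i1, i2, i3⟩ := ih hy'
      refine ⟨by simp [h1], ?_, ?_⟩
      · intro c hc
        rcases List.mem_cons.1 hc with rfl | hc
        · simp [List.mem_of_mem_head? h1]
        · simp [i2 c hc]
      · intro h3 c hc
        rcases List.mem_append.1 hc with hc | hc
        · rw [h2 c hc]
          exact h3 a (by simp)
        rcases List.mem_append.1 hc with hc | hc
        · rw [linkWt] at hy
          by_cases hl : IsWordOver A (a :: (y ++ [b])) ∧ IsLinked M u (a :: (y ++ [b]))
          · exact hl.1 c (by simp [hc])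
          · rw [if_neg hl, convOne, if_neg (List.ne_nil_of_mem hc)] at hy
            simp at hy
        · exact i3 (fun d hd => h3 d (by simp [hd])) c hc

variable (A M u)

open Classical in
/-- The sum of the weights of all the block structures on a word. -/
def totalBlockWt (w : List ℕ+) : Polynomial ℤ :=
  ∑ S ∈ (w.toFinset.filter (· ∈ A)).powerset, blockWt A M u (S.sort (· ≤ ·)) w

/-- Sets `S` with a letter missing from `w` contribute zero, so the index set may be enlarged. This
allows one `Q` to serve all factors of a word, or all words of a given content. -/
theorem totalBlockWt_eq (w : List ℕ+) (Q : Finset ℕ+) (hQ : ∀ a ∈ w, a ∈ A → a ∈ Q)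
    (hQA : ∀ a ∈ Q, a ∈ A) :
    totalBlockWt A M u w = ∑ S ∈ Q.powerset, blockWt A M u (S.sort (· ≤ ·)) w := by
  classical
  rw [totalBlockWt]
  refine Finset.sum_subset ?_ ?_
  · refine Finset.powerset_mono.2 fun a ha => ?_
    simp only [Finset.mem_filter, List.mem_toFinset] at ha
    exact hQ a ha.1 ha.2
  · intro S hS hS'
    by_contra h
    obtain ⟨-, h2, -⟩ := blockWt_ne_zero h
    refine hS' (Finset.mem_powerset.2 fun a ha => ?_)
    simp only [Finset.mem_filter, List.mem_toFinset]
    exact ⟨h2 a ((Finset.mem_sort _).2 ha), hQA a (Finset.mem_powerset.1 hS ha)⟩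

theorem totalBlockWt_ne_zero {w : List ℕ+} (h : totalBlockWt A M u w ≠ 0) : IsWordOver A w := by
  classical
  obtain ⟨S, hS, h1⟩ := Finset.exists_ne_zero_of_sum_ne_zero h
  refine (blockWt_ne_zero h1).2.2 fun a ha => ?_
  exact (Finset.mem_filter.1 (Finset.mem_powerset.1 hS ((Finset.mem_sort _).1 ha))).2

theorem wordSeries_zero : wordSeries (fun _ => 0) = 0 := by
  simpa using wordSeries_sum (∅ : Finset ℕ) fun _ _ => 0

theorem denomK_eq (k : ℕ+) :
    denomK k M u = 1 - toT x * wordSeries (totalBlockWt (Set.Iic k) M u) := by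
  classical
  have h : totalBlockWt (Set.Iic k) M u = fun w => ∑ S ∈ (Finset.Icc 1 k).powerset,
      blockWt (Set.Iic k) M u (S.sort (· ≤ ·)) w := by
    funext w
    exact totalBlockWt_eq _ _ _ _ _ (by simp) (by simp)
  rw [denomK, h, wordSeries_sum]
  congr 2
  have hc : (Finset.Icc 1 k).card = k := by simp
  rw [Finset.sum_powerset, hc]
  have h0 : ∀ n ∈ Finset.Icc 1 (k : ℕ), t ^ n * ∑ S ∈ Finset.powersetCard n (Finset.Icc 1 k),
      RXTZ (Set.Iic k) M u S = ∑ S ∈ Finset.powersetCard n (Finset.Icc 1 k),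
        wordSeries (blockWt (Set.Iic k) M u (S.sort (· ≤ ·))) := by
    intro n hn
    rw [Finset.mul_sum]
    refine Finset.sum_congr rfl fun S hS => ?_
    have hS' := (Finset.mem_powersetCard.1 hS).2
    rw [wordSeries_blockWt_sort, hS']
    rw [← Finset.card_pos, hS']
    exact (Finset.mem_Icc.1 hn).1
  rw [Finset.sum_congr rfl h0]
  refine Finset.sum_subset (fun n hn => ?_) fun n hn hn' => ?_
  · simp only [Finset.mem_Icc, Finset.mem_range] at hn ⊢
    omega
  -- The full powerset also contains the empty set, whose block weight is zero.
  · have : n = 0 := by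
      simp only [Finset.mem_Icc, Finset.mem_range] at hn hn'
      omega
    subst this
    simp [blockWt, wordSeries_zero]

theorem coeff_wordSeries_blockWt_ne_zero {S : Finset ℕ+} {n : ℕ} {d : ℕ+ →₀ ℕ}
    (h : MvPowerSeries.coeff d (PowerSeries.coeff n
      (wordSeries (blockWt A M u (S.sort (· ≤ ·))))) ≠ 0) : S ⊆ d.support := by
  classical
  rw [coeff_wordSeries] at h
  obtain ⟨w, hw, h1⟩ := Finset.exists_ne_zero_of_sum_ne_zero h
  split_ifs at h1
  · intro a ha
    have := (blockWt_ne_zero h1).2.1 a ((Finset.mem_sort _).2 ha)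
    rw [mem_wordsOf] at hw
    simpa [hw] using this
  · exact absurd rfl h1

theorem coeff_RXTZSum (n m : ℕ) (hn : 1 ≤ n) (d : ℕ+ →₀ ℕ) :
    MvPowerSeries.coeff d (PowerSeries.coeff m (t ^ n * RXTZSum M u n)) =
      ∑ S ∈ d.support.powerset with S.card = n, MvPowerSeries.coeff d (PowerSeries.coeff m
        (wordSeries (blockWt Set.univ M u (S.sort (· ≤ ·))))) := by
  classical
  rw [← finsum_subtype_eq_sum (fun S : Finset ℕ+ => S.card = n)]
  · have h : ∀ S : {S : Finset ℕ+ // S.card = n},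
        wordSeries (blockWt Set.univ M u (S.1.sort (· ≤ ·))) = t ^ n * RXTZ Set.univ M u S.1 := by
      rintro ⟨S, rfl⟩
      exact wordSeries_blockWt_sort _ _ _ _ (Finset.card_pos.1 hn)
    simp only [h, t, PowerSeries.coeff_X_pow_mul']
    split_ifs with hnm
    · rw [RXTZSum, tSum, PowerSeries.coeff_mk]
      rfl
    · simp
  · intro S _ hS
    exact Finset.mem_powerset.2 (coeff_wordSeries_blockWt_ne_zero _ _ _ hS)

/-- At a fixed content `d` only subsets of the support of `d` matter, so both infinite sums reduce
to one sum over its powerset, grouped by cardinality. -/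
theorem denomPP_eq :
    denomPP M u = 1 - toT x * wordSeries (totalBlockWt Set.univ M u) := by
  classical
  rw [denomPP]
  congr 2
  refine tSeries_ext fun m d => ?_
  rw [tSum, PowerSeries.coeff_mk]
  change ∑ᶠ n : {n : ℕ // 1 ≤ n}, MvPowerSeries.coeff d
    (PowerSeries.coeff m (t ^ n.1 * RXTZSum M u n.1)) = _
  rw [finsum_subtype_eq_sum (fun n : ℕ => 1 ≤ n) (fun n => MvPowerSeries.coeff d
    (PowerSeries.coeff m (t ^ n * RXTZSum M u n))) (Finset.range (d.support.card + 1))]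
  · rw [Finset.sum_congr rfl fun n hn => coeff_RXTZSum M u n m (Finset.mem_filter.1 hn).2 d]
    have h : MvPowerSeries.coeff d (PowerSeries.coeff m
        (wordSeries (totalBlockWt Set.univ M u))) = ∑ S ∈ d.support.powerset,
        MvPowerSeries.coeff d (PowerSeries.coeff m
          (wordSeries (blockWt Set.univ M u (S.sort (· ≤ ·))))) := by
      simp only [coeff_wordSeries]
      rw [Finset.sum_comm]
      refine Finset.sum_congr rfl fun w hw => ?_
      split_ifs
      · refine totalBlockWt_eq _ _ _ _ _ (fun a ha _ => ?_) (by simp)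
        rw [mem_wordsOf] at hw
        simpa [hw] using ha
      · simp
    rw [h, ← Finset.sum_fiberwise_of_maps_to (s := d.support.powerset)
      (t := Finset.range (d.support.card + 1)) (g := Finset.card)]
    · refine Finset.sum_subset (Finset.filter_subset _ _) fun n hn hn' => ?_
      have : n = 0 := by
        simp only [Finset.mem_filter, hn, true_and] at hn'
        omega
      subst this
      refine Finset.sum_eq_zero fun S hS => ?_
      have hS' : S = ∅ := Finset.card_eq_zero.1 (Finset.mem_filter.1 hS).2
      simp [hS', blockWt, wordSeries_zero]
    · intro S hS
      rw [Finset.mem_range, Nat.lt_succ_iff]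
      exact Finset.card_le_card (Finset.mem_powerset.1 hS)
  · intro n hn h
    rw [coeff_RXTZSum M u n m hn d] at h
    obtain ⟨S, hS, -⟩ := Finset.exists_ne_zero_of_sum_ne_zero h
    rw [Finset.mem_filter] at hS
    rw [Finset.mem_range, Nat.lt_succ_iff, ← hS.2]
    exact Finset.card_le_card (Finset.mem_powerset.1 hS.1)

open Classical in
/-- The coefficients of `avoidGF A M u`. -/
def avoidWt (w : List ℕ+) : Polynomial ℤ :=
  if IsWordOver A w ∧ mch M u w = 0 then
    (if w = [] then 1 else Polynomial.X ^ (des w + 1)) else 0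

theorem coeff_one_of_eq {n : ℕ} (hn : n = 0) : PowerSeries.coeff n (1 : TSeries) = 1 := by
  simp [hn]

theorem avoidGF_eq : avoidGF A M u = wordSeries (avoidWt A M u) := by
  classical
  refine tSeries_ext fun n d => ?_
  rw [avoidGF, PowerSeries.coeff_mk, coeff_wordSeries]
  split_ifs with hn
  · rw [← coeff_one_of_eq hn, ← wordSeries_convOne, coeff_wordSeries]
    refine Finset.sum_congr rfl fun w _ => ?_
    split_ifs with hw
    · have : w = [] := List.length_eq_zero_iff.1 (hw.trans hn)
      subst this
      simp [avoidWt, convOne, IsWordOver, mch, matchPositions]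
    · rfl
  · rw [avoidCoeff]
    have h := zSum_zWord (fun w => w.length = n ∧ IsWordOver A w ∧ mch M u w = 0)
      (fun w => Polynomial.X ^ (des w + 1)) d
    have h1 : ∀ w, wordTerm w = MvPowerSeries.C (Polynomial.X ^ (des w + 1)) * zWord w := by
      simp [wordTerm, x]
    simp only [h1]
    rw [h]
    refine Finset.sum_congr rfl fun w _ => ?_
    by_cases hw : w.length = n
    · have : w ≠ [] := by
        rintro rfl
        exact hn hw.symm
      simp [avoidWt, hw, this]
    · simp [hw]

end

end WordMatch

/-! ### Matches, descents and the cancellation over linked prefixes -/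

namespace WordMatch

noncomputable section

/-- The letter of `w` at the (0-based) position `i`. -/
def letter (w : List ℕ+) (i : ℕ) : ℕ+ := w.getD i 1

theorem letter_eq {w : List ℕ+} {i : ℕ} (h : i < w.length) : letter w i = w[i] := by
  simp [letter, h]

theorem letter_drop (w : List ℕ+) (p i : ℕ) : letter (w.drop p) i = letter w (p + i) := by
  simp [letter, List.getD_eq_getElem?_getD]

theorem letter_take (w : List ℕ+) {n i : ℕ} (h : i < n) : letter (w.take n) i = letter w i := by
  simp [letter, List.getD_eq_getElem?_getD, h]

/-- The positions of the descents of `w`. -/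
def descents (w : List ℕ+) : Finset ℕ :=
  (Finset.range (w.length - 1)).filter fun i => letter w (i + 1) < letter w i

theorem mem_descents {w : List ℕ+} {i : ℕ} :
    i ∈ descents w ↔ i + 1 < w.length ∧ letter w (i + 1) < letter w i := by
  rw [descents, Finset.mem_filter, Finset.mem_range, Nat.lt_sub_iff_add_lt]

theorem des_cons_cons (a b : ℕ+) (w : List ℕ+) :
    des (a :: b :: w) = (if b < a then 1 else 0) + des (b :: w) := by
  simp [des, List.countP_cons, add_comm]

theorem des_eq_card (w : List ℕ+) : des w = (descents w).card := by
  induction w with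
  | nil => simp [des, descents]
  | cons a w ih =>
    cases w with
    | nil => simp [des, descents]
    | cons b w =>
      rw [des_cons_cons, ih, descents, descents, Finset.card_filter, Finset.card_filter]
      simp only [List.length_cons, Nat.add_sub_cancel]
      rw [Finset.sum_range_succ', add_comm]
      simp [letter]

theorem length_red (v : List ℕ+) : (red v).length = v.length := by
  simp [red]

/-- Counting the distinct letters below a given letter is strictly monotone. Through this lemma
every order comparison inside a match is read off from `u`. -/
theorem letter_red_lt {v : List ℕ+} {i k : ℕ} (hi : i < v.length) (hk : k < v.length) :
    letter (red v) i < letter (red v) k ↔ letter v i < letter v k := by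
  classical
  have key : ∀ i (hi : i < v.length), letter (red v) i =
      Nat.succPNat (v.toFinset.filter fun b => b < letter v i).card := by
    intro i hi
    rw [letter_eq (by rwa [length_red]), letter_eq hi]
    simp only [red, List.getElem_map]
  have hlt : ∀ i k, i < v.length → k < v.length → letter v i < letter v k →
      letter (red v) i < letter (red v) k := by
    intro i k hi hk h
    rw [key i hi, key k hk, Nat.succPNat_lt_succPNat]
    refine Finset.card_lt_card ⟨fun b hb => ?_, fun hsub => ?_⟩
    · rw [Finset.mem_filter] at hb ⊢
      exact ⟨hb.1, hb.2.trans h⟩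
    · have hmem : letter v i ∈ v.toFinset.filter fun b => b < letter v k := by
        rw [Finset.mem_filter, List.mem_toFinset]
        exact ⟨by rw [letter_eq hi]; exact List.getElem_mem hi, h⟩
      exact lt_irrefl _ (Finset.mem_filter.1 (hsub hmem)).2
  refine ⟨fun h => ?_, hlt i k hi hk⟩
  by_contra hn
  rcases (not_lt.1 hn).lt_or_eq with h1 | h1
  · exact lt_asymm h (hlt k i hk hi h1)
  · rw [key i hi, key k hk, h1] at h
    exact lt_irrefl _ h

variable {A : Set ℕ+} {M : List ℕ+ → List ℕ+ → Prop} {u w : List ℕ+}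

theorem mem_matchPositions {q : ℕ} :
    q ∈ matchPositions M u w ↔ q < w.length ∧ M u ((w.drop q).take u.length) := by
  classical
  rw [matchPositions, Finset.mem_filter, Finset.mem_range]

/-- Near the end of `w` the factor taken is truncated, but `red` preserves length, so a truncated
factor is never a match. -/
theorem add_length_le_of_mem (hM : ∀ v, M u v → red v = u) {q : ℕ}
    (hq : q ∈ matchPositions M u w) : q + u.length ≤ w.length := by
  obtain ⟨h1, h2⟩ := mem_matchPositions.1 hq
  have := congrArg List.length (hM _ h2)
  rw [length_red, List.length_take, List.length_drop] at this
  omega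

theorem mem_matchPositions' (hM : ∀ v, M u v → red v = u) (hu : u ≠ []) {q : ℕ} :
    q ∈ matchPositions M u w ↔ q + u.length ≤ w.length ∧ M u ((w.drop q).take u.length) := by
  refine ⟨fun h => ⟨add_length_le_of_mem hM h, (mem_matchPositions.1 h).2⟩,
    fun h => mem_matchPositions.2 ⟨?_, h.2⟩⟩
  have := List.length_pos_iff.2 hu
  omega

theorem letter_lt_of_mem (hM : ∀ v, M u v → red v = u) {q i k : ℕ}
    (hq : q ∈ matchPositions M u w) (hi : i < u.length) (hk : k < u.length) :
    letter w (q + i) < letter w (q + k) ↔ letter u i < letter u k := by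
  have h1 := add_length_le_of_mem hM hq
  have h2 := hM _ (mem_matchPositions.1 hq).2
  have hl : ((w.drop q).take u.length).length = u.length := by
    rw [List.length_take, List.length_drop]
    omega
  have h3 := letter_red_lt (v := (w.drop q).take u.length) (hl ▸ hi) (hl ▸ hk)
  rw [h2, letter_take _ hi, letter_take _ hk, letter_drop, letter_drop] at h3
  exact h3.symm

theorem matchPositions_take (hM : ∀ v, M u v → red v = u) (hu : u ≠ []) {n : ℕ}
    (hn : n ≤ w.length) :
    matchPositions M u (w.take n) = (matchPositions M u w).filter fun q => q + u.length ≤ n := by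
  ext q
  rw [Finset.mem_filter, mem_matchPositions' hM hu, mem_matchPositions' hM hu, List.length_take,
    min_eq_left hn, List.drop_take, List.take_take]
  constructor
  · rintro ⟨h1, h2⟩
    rw [min_eq_left (by omega)] at h2
    exact ⟨⟨by omega, h2⟩, h1⟩
  · rintro ⟨⟨h1, h2⟩, h3⟩
    rw [min_eq_left (by omega)]
    exact ⟨h3, h2⟩

theorem mem_matchPositions_drop {p q : ℕ} :
    q ∈ matchPositions M u (w.drop p) ↔ p + q ∈ matchPositions M u w := by
  rw [mem_matchPositions, mem_matchPositions, List.drop_drop, List.length_drop]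
  refine and_congr_left fun _ => ?_
  omega

theorem mch_drop_eq_zero {p : ℕ} :
    mch M u (w.drop p) = 0 ↔ ∀ q ∈ matchPositions M u w, q < p := by
  rw [mch, Finset.card_eq_zero, Finset.eq_empty_iff_forall_notMem]
  simp only [mem_matchPositions_drop]
  constructor
  · intro h q hq
    by_contra hlt
    exact h (q - p) (by rwa [Nat.add_sub_cancel' (not_lt.1 hlt)])
  · intro h q hq
    have := h _ hq
    omega

/-- Consecutive elements of `P`, up to `m`, are the starting positions of words of length `j`
that share at least two letters. -/
def Linked (P : Finset ℕ) (j m : ℕ) : Prop :=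
  ∀ p ∈ P, ∀ q ∈ P, q ≤ m → p < q → (∀ r ∈ P, ¬ (p < r ∧ r < q)) → q + 2 ≤ p + j

theorem isLinked_take (hM : ∀ v, M u v → red v = u) (hu : u ≠ []) {n : ℕ} (hn : n ≤ w.length) :
    IsLinked M u (w.take n) ↔ 0 ∈ matchPositions M u w ∧
      ∃ m ∈ matchPositions M u w, m + u.length = n ∧
        Linked (matchPositions M u w) u.length m := by
  rw [IsLinked, matchPositions_take hM hu hn, List.length_take, min_eq_left hn]
  simp only [Finset.mem_filter]
  constructor
  · rintro ⟨h0, ⟨m, hm, hmn⟩, h⟩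
    refine ⟨h0.1, m, hm.1, hmn, fun p hp q hq hqm hpq hr => ?_⟩
    exact h p ⟨hp, by omega⟩ q ⟨hq, by omega⟩ hpq fun r hr' => hr r hr'.1
  · rintro ⟨h0, m, hm, hmn, h⟩
    refine ⟨⟨h0, by omega⟩, ⟨m, ⟨hm, by omega⟩, hmn⟩, fun p hp q hq hpq hr => ?_⟩
    refine h p hp.1 q hq.1 (by omega) hpq fun r hr' hpr => hr r ⟨hr', by omega⟩ hpr

/-- Signed count of the ends of the linked initial segments of `P` after which no element of `P`
is left. -/
theorem sum_linked (P : Finset ℕ) (j : ℕ) (hj : 2 ≤ j) (h0 : 0 ∈ P)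
    (hgap : ∀ p ∈ P, ∀ q ∈ P, ∀ r ∈ P, p < q → q < r → p + j ≤ r + 1) :
    (∑ m ∈ P, open Classical in if Linked P j m ∧ ∀ q ∈ P, q + 1 < m + j then
      (-1 : Polynomial ℤ) ^ (P.filter (· ≤ m)).card else 0) = if P = {0} then -1 else 0 := by
  classical
  split_ifs with hP
  · subst hP
    rw [Finset.sum_singleton, if_pos]
    · simp [Finset.filter_singleton]
    · refine ⟨fun p hp q hq => ?_, fun q hq => ?_⟩
      · rw [Finset.mem_singleton] at hp hq
        omega
      · rw [Finset.mem_singleton] at hq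
        omega
  · obtain ⟨m, hm, hmax⟩ := P.exists_max_image id ⟨0, h0⟩
    simp only [id] at hmax
    have hm0 : m ≠ 0 := by
      rintro rfl
      refine hP (Finset.eq_singleton_iff_unique_mem.2 ⟨h0, fun q hq => ?_⟩)
      have := hmax q hq
      omega
    -- The last two elements `m' < m` carry the cancelling terms. The gap condition makes every
    -- earlier candidate end before the match at `m` starts, or on its first letter, so that match
    -- is left over.
    obtain ⟨m', hm', hmax'⟩ := (P.erase m).exists_max_image id
      ⟨0, Finset.mem_erase.2 ⟨hm0.symm, h0⟩⟩
    simp only [id, Finset.mem_erase] at hm' hmax'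
    have hlt : m' < m := lt_of_le_of_ne (hmax _ hm'.2) hm'.1
    have hle : ∀ q ∈ P, q ≤ m' ∨ q = m := fun q hq => by
      by_cases h : q = m
      · exact Or.inr h
      · exact Or.inl (hmax' q ⟨h, hq⟩)
    rw [Finset.sum_eq_add_of_mem m m' hm hm'.2 hlt.ne']
    · have hcard : (P.filter (· ≤ m)).card = (P.filter (· ≤ m')).card + 1 := by
        have : P.filter (· ≤ m) = insert m (P.filter (· ≤ m')) := by
          ext q
          rw [Finset.mem_insert, Finset.mem_filter, Finset.mem_filter]
          constructor
          · rintro ⟨hq, -⟩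
            rcases hle q hq with h | h
            · exact Or.inr ⟨hq, h⟩
            · exact Or.inl h
          · rintro (rfl | ⟨hq, h⟩)
            · exact ⟨hm, le_rfl⟩
            · exact ⟨hq, by omega⟩
        rw [this, Finset.card_insert_of_notMem]
        simp [hlt]
      -- Each side says that the chain is linked up to `m'` and that `m + 2 ≤ m' + j`. For `m` this
      -- is the last link; for `m'` it says that no match is left over.
      have hiff : (Linked P j m ∧ ∀ q ∈ P, q + 1 < m + j) ↔
          (Linked P j m' ∧ ∀ q ∈ P, q + 1 < m' + j) := by
        constructor
        · rintro ⟨h1, -⟩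
          refine ⟨fun p hp q hq hqm => h1 p hp q hq (by omega), fun q hq => ?_⟩
          have h2 := h1 m' hm'.2 m hm le_rfl hlt fun r hr hr' => by
            rcases hle r hr with h | h <;> omega
          have := hmax q hq
          omega
        · rintro ⟨h1, h2⟩
          refine ⟨fun p hp q hq hqm hpq hr => ?_, fun q hq => ?_⟩
          · rcases hle q hq with h | rfl
            · exact h1 p hp q hq h hpq hr
            · have h3 := h2 q hm
              rcases hle p hp with h | h
              · have h4 := hr m' hm'.2
                have : p = m' := by omega
                omega
              · omega
          · have := hmax q hq
            omega
      rw [if_congr hiff rfl rfl, hcard]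
      split_ifs
      · ring
      · ring
    · intro c hc hne
      rw [if_neg]
      rintro ⟨-, h⟩
      have h1 := h m hm
      rcases hle c hc with h2 | h2
      · have := hgap c hc m' hm'.2 m hm (by omega) hlt
        omega
      · exact hne.1 h2

/-- Take the last start not exceeding `i` and `m`. If its match missed the pair `(i, i + 1)`, the
next start would come early enough, by the two shared letters, to contradict maximality. -/
theorem exists_covering (P : Finset ℕ) (j m i : ℕ) (h0 : 0 ∈ P) (hm : m ∈ P)
    (hl : Linked P j m) (hi : i + 1 < m + j) :
    ∃ q ∈ P, q ≤ m ∧ q ≤ i ∧ i + 1 < q + j := by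
  classical
  obtain ⟨q, hq, hmax⟩ := (P.filter fun q => q ≤ i ∧ q ≤ m).exists_max_image id
    ⟨0, by simp [h0]⟩
  simp only [id, Finset.mem_filter] at hq hmax
  refine ⟨q, hq.1, hq.2.2, hq.2.1, ?_⟩
  by_contra hn
  have hqm : q < m := by
    rcases hq.2.2.lt_or_eq with h | rfl
    · exact h
    · omega
  obtain ⟨r, hr, hmin⟩ := (P.filter fun r => q < r).exists_min_image id ⟨m, by simp [hm, hqm]⟩
  simp only [id, Finset.mem_filter] at hr hmin
  have h1 := hmin m ⟨hm, hqm⟩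
  have h2 := hl q hq.1 r hr.1 h1 hr.2 fun s hs hs' => by
    have := hmin s ⟨hs, hs'.1⟩
    omega
  have := hmax r ⟨hr.1, by omega, h1⟩
  omega

theorem mem_descents_of_mem (hM : ∀ v, M u v → red v = u) {d : ℕ} (hd : descents u = {d})
    {q i : ℕ} (hq : q ∈ matchPositions M u w) (h1 : q ≤ i) (h2 : i + 1 < q + u.length) :
    i ∈ descents w ↔ i = q + d := by
  obtain ⟨k, rfl⟩ := Nat.exists_eq_add_of_le h1
  have hl := add_length_le_of_mem hM hq
  have h3 : k ∈ descents u ↔ k = d := by rw [hd, Finset.mem_singleton]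
  rw [mem_descents] at h3 ⊢
  rw [add_assoc, letter_lt_of_mem hM hq (by omega) (by omega)]
  constructor
  · intro h
    have := h3.1 ⟨by omega, h.2⟩
    omega
  · intro h
    exact ⟨by omega, (h3.2 (by omega)).2⟩

theorem descent_lt (hM : ∀ v, M u v → red v = u) {d : ℕ} (hd : descents u = {d})
    {q : ℕ} (hq : q ∈ matchPositions M u w) : d + 1 < u.length ∧ q + d ∈ descents w := by
  have h : d ∈ descents u := by simp [hd]
  have h1 := (mem_descents.1 h).1
  exact ⟨h1, (mem_descents_of_mem hM hd hq (by omega) (by omega)).2 rfl⟩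

/-- If the matches at `p` and `r` shared two letters, they would cover every adjacent pair of the
match at `q` between them. The descent of the middle match would then be the descent of an outer
one, forcing equal starts. -/
theorem matchPositions_gap (hM : ∀ v, M u v → red v = u) {d : ℕ} (hd : descents u = {d})
    {p q r : ℕ} (hp : p ∈ matchPositions M u w) (hq : q ∈ matchPositions M u w)
    (hr : r ∈ matchPositions M u w) (hpq : p < q) (hqr : q < r) : p + u.length ≤ r + 1 := by
  by_contra hlt
  obtain ⟨h1, h2⟩ := descent_lt hM hd hq
  by_cases h4 : p + u.length ≤ q + d + 1
  · by_cases h5 : r ≤ q + d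
    · have := (mem_descents_of_mem hM hd hr h5 (by omega)).1 h2
      omega
    · omega
  · have := (mem_descents_of_mem hM hd hp (i := q + d) (by omega) (by omega)).1 h2
    omega

theorem des_drop (w : List ℕ+) (p : ℕ) :
    des (w.drop p) = ((descents w).filter (p ≤ ·)).card := by
  rw [des_eq_card]
  refine Finset.card_bij (fun i _ => p + i) ?_ ?_ ?_
  · intro i hi
    rw [mem_descents, List.length_drop, letter_drop, letter_drop] at hi
    rw [Finset.mem_filter, mem_descents]
    exact ⟨⟨by omega, hi.2⟩, by omega⟩
  · intro i _ k _ h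
    omega
  · intro i hi
    rw [Finset.mem_filter, mem_descents] at hi
    obtain ⟨k, rfl⟩ := Nat.exists_eq_add_of_le hi.2
    refine ⟨k, ?_, rfl⟩
    rw [mem_descents, List.length_drop, letter_drop, letter_drop]
    exact ⟨by omega, hi.1.2⟩

/-- The map `q ↦ q + d` is a bijection from the matches of the linked prefix to its descents, onto
because the matches cover all adjacent pairs. Here `p` is the position of the last letter of the
prefix, which is also the first letter of the remainder. -/
theorem des_eq_of_linked (hM : ∀ v, M u v → red v = u) {d : ℕ} (hd : descents u = {d}) {m p : ℕ}
    (h0 : 0 ∈ matchPositions M u w) (hm : m ∈ matchPositions M u w) (hmp : m + u.length = p + 1)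
    (hl : Linked (matchPositions M u w) u.length m) :
    des w = ((matchPositions M u w).filter (· ≤ m)).card + des (w.drop p) := by
  classical
  have h1 : ((matchPositions M u w).filter (· ≤ m)).card =
      ((descents w).filter fun i => ¬ p ≤ i).card := by
    refine Finset.card_bij (fun q _ => q + d) ?_ ?_ ?_
    · intro q hq
      rw [Finset.mem_filter] at hq ⊢
      have := descent_lt hM hd hq.1
      exact ⟨this.2, by omega⟩
    · intro i _ k _ h
      omega
    · intro i hi
      rw [Finset.mem_filter] at hi
      obtain ⟨q, hq, h2, h3, h4⟩ := exists_covering _ _ m i h0 hm hl (by omega)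
      exact ⟨q, Finset.mem_filter.2 ⟨hq, h2⟩, ((mem_descents_of_mem hM hd hq h3 h4).1 hi.1).symm⟩
  rw [h1, des_drop, des_eq_card, add_comm, Finset.card_filter_add_card_filter_not]

/-- The first letter of a linked sequence is smaller than the last one. -/
theorem letter_lt_of_isLinked (hM : ∀ v, M u v → red v = u) (hu : u ≠ [])
    (hlt : letter u 0 < letter u (u.length - 1)) (hwi : WeaklyIncreasingOverlap A u)
    (hw : IsWordOver A w) (hl : IsLinked M u w) : letter w 0 < letter w (w.length - 1) := by
  classical
  have hj := List.length_pos_iff.2 hu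
  have hl' := (isLinked_take hM hu (w := w) (n := w.length) le_rfl).1
    (by rwa [List.take_length])
  obtain ⟨h0, m, hm, hmw, h⟩ := hl'
  have step : ∀ p ∈ matchPositions M u w, ∀ q ∈ matchPositions M u w, p < q →
      q + 2 ≤ p + u.length → letter w p ≤ letter w q := by
    intro p hp q hq hpq hpq'
    have h1 := add_length_le_of_mem hM hq
    -- `St` is 1-based, while `q - p` is the 0-based offset of the second match.
    have hs : q - p + 1 ∈ St A u := by
      refine ⟨by omega, by omega, (w.drop p).take (q - p + u.length), ?_, ?_, ?_, ?_⟩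
      · exact fun a ha => hw a (List.mem_of_mem_drop (List.mem_of_mem_take ha))
      · rw [List.length_take, List.length_drop]
        omega
      · rw [List.take_take, min_eq_left (by omega)]
        exact hM _ (mem_matchPositions.1 hp).2
      · rw [List.drop_take, List.drop_drop]
        have e1 : p + (q - p + 1 - 1) = q := by omega
        have e2 : q - p + u.length - (q - p + 1 - 1) = u.length := by omega
        rw [e1, e2]
        exact hM _ (mem_matchPositions.1 hq).2
    have hlen : q - p < u.length := by omega
    have h2 := hwi _ hs (letter u 0) (by rw [letter_eq hj]; simp [hj])
      (letter u (q - p)) (by rw [letter_eq hlen]; simp [hlen])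
    by_contra hn
    have h3 := (letter_lt_of_mem hM hp (i := q - p) (k := 0) hlen hj).1 (by
      rw [Nat.add_sub_cancel' hpq.le]
      simpa using hn)
    exact absurd h2 (not_le.2 h3)
  have main : ∀ q, q ∈ matchPositions M u w → q ≤ m → letter w 0 ≤ letter w q := by
    intro q
    induction q using Nat.strong_induction_on with
    | _ q ih =>
      intro hq hqm
      rcases Nat.eq_zero_or_pos q with rfl | hpos
      · exact le_rfl
      obtain ⟨p, hp, hmax⟩ := ((matchPositions M u w).filter (· < q)).exists_max_image id
        ⟨0, by simp [h0, hpos]⟩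
      simp only [id, Finset.mem_filter] at hp hmax
      refine (ih p hp.2 hp.1 (by omega)).trans (step p hp.1 q hq hp.2 ?_)
      refine h p hp.1 q hq hqm hp.2 fun r hr hr' => ?_
      have := hmax r ⟨hr, hr'.2⟩
      omega
  -- The starts of the matches only give a weak increase; strictness comes from `u_1 < u_j` in the
  -- final match.
  have h1 := (letter_lt_of_mem hM hm (i := 0) (k := u.length - 1) hj (by omega)).2 hlt
  rw [add_zero] at h1
  have h2 : m + (u.length - 1) = w.length - 1 := by omega
  rw [h2] at h1
  exact (main m hm le_rfl).trans_lt h1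

open Classical in
/-- The sum over the initial segments of `w` that are linked sequences. -/
theorem sum_isLinked_take (hM : ∀ v, M u v → red v = u) {d : ℕ} (hd : descents u = {d}) :
    (∑ p ∈ Finset.range w.length, if IsLinked M u (w.take (p + 1)) then
      (-Polynomial.X) ^ mch M u (w.take (p + 1)) *
        (if mch M u (w.drop p) = 0 then (Polynomial.X : Polynomial ℤ) ^ (des (w.drop p) + 1) else 0)
      else 0) =
    Polynomial.X ^ (des w + 1) *
      ((if mch M u w = 0 then 1 else 0) - if mch M u (w.drop 1) = 0 then 1 else 0) := by
  have hu : u ≠ [] := by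
    rintro rfl
    simp [descents] at hd
  have hj : 2 ≤ u.length := by
    have : d ∈ descents u := by simp [hd]
    have := (mem_descents.1 this).1
    omega
  set P := matchPositions M u w with hP
  have hw0 : mch M u w = 0 ↔ P = ∅ := Finset.card_eq_zero
  by_cases h0 : 0 ∈ P
  · have hne : ¬ mch M u w = 0 := fun h => by
      rw [hw0.1 h] at h0
      simp at h0
    have hw1 : mch M u (w.drop 1) = 0 ↔ P = {0} := by
      rw [mch_drop_eq_zero, Finset.eq_singleton_iff_unique_mem]
      simp only [Nat.lt_one_iff]
      exact (and_iff_right h0).symm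
    -- The prefix and the remainder share the letter at `p`, so a prefix ending with the match at
    -- `m` has `p + 1 = m + u.length`. The powers of `x` combine to that of the whole word, leaving
    -- a sign.
    have hterm : ∀ p ∈ Finset.range w.length, (if IsLinked M u (w.take (p + 1)) then
        (-Polynomial.X) ^ mch M u (w.take (p + 1)) * (if mch M u (w.drop p) = 0 then
          (Polynomial.X : Polynomial ℤ) ^ (des (w.drop p) + 1) else 0) else 0) =
        ∑ m ∈ P, if m + u.length = p + 1 then (if Linked P u.length m ∧ ∀ q ∈ P, q + 1 < m + u.length
          then Polynomial.X ^ (des w + 1) * (-1) ^ (P.filter (· ≤ m)).card else 0) else 0 := by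
      intro p hp
      have hpw : p + 1 ≤ w.length := Finset.mem_range.1 hp
      by_cases hm : ∃ m ∈ P, m + u.length = p + 1
      · obtain ⟨m, hm, hmp⟩ := hm
        rw [Finset.sum_eq_single_of_mem m hm fun b _ hb => if_neg (by omega), if_pos hmp]
        have e1 : IsLinked M u (w.take (p + 1)) ↔ Linked P u.length m := by
          rw [isLinked_take hM hu hpw]
          constructor
          · rintro ⟨-, m', -, hm', h⟩
            obtain rfl : m' = m := by omega
            exact h
          · exact fun h => ⟨h0, m, hm, hmp, h⟩
        have e2 : mch M u (w.drop p) = 0 ↔ ∀ q ∈ P, q + 1 < m + u.length := by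
          rw [mch_drop_eq_zero]
          refine forall₂_congr fun q _ => ?_
          omega
        have e3 : mch M u (w.take (p + 1)) = (P.filter (· ≤ m)).card := by
          rw [mch, matchPositions_take hM hu hpw]
          congr 1
          refine Finset.filter_congr fun q _ => ?_
          omega
        rw [if_congr e1 rfl rfl, if_congr e2 rfl rfl, e3]
        by_cases h1 : Linked P u.length m
        · by_cases h2 : ∀ q ∈ P, q + 1 < m + u.length
          · rw [if_pos h1, if_pos h2, if_pos ⟨h1, h2⟩, des_eq_of_linked hM hd h0 hm hmp h1,
              neg_pow]
            ring
          · have h3 : ¬ (Linked P u.length m ∧ ∀ q ∈ P, q + 1 < m + u.length) := fun h => h2 h.2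
            rw [if_neg h2, if_neg h3, mul_zero, ite_self]
        · rw [if_neg h1, if_neg fun h => h1 h.1]
      · rw [if_neg, Finset.sum_eq_zero]
        · exact fun m hm' => if_neg fun h => hm ⟨m, hm', h⟩
        · rw [isLinked_take hM hu hpw]
          rintro ⟨-, m, hm', h, -⟩
          exact hm ⟨m, hm', h⟩
    rw [Finset.sum_congr rfl hterm, Finset.sum_comm]
    have hinner : ∀ m ∈ P, (∑ p ∈ Finset.range w.length, if m + u.length = p + 1 then
        (if Linked P u.length m ∧ ∀ q ∈ P, q + 1 < m + u.length
          then Polynomial.X ^ (des w + 1) * (-1 : Polynomial ℤ) ^ (P.filter (· ≤ m)).card else 0)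
        else 0) = Polynomial.X ^ (des w + 1) *
        if Linked P u.length m ∧ ∀ q ∈ P, q + 1 < m + u.length then
          (-1 : Polynomial ℤ) ^ (P.filter (· ≤ m)).card else 0 := by
      intro m hm
      have := add_length_le_of_mem hM hm
      rw [Finset.sum_eq_single_of_mem (m + u.length - 1) (by rw [Finset.mem_range]; omega)
        fun b _ hb => if_neg (by omega), if_pos (by omega), mul_ite, mul_zero]
    rw [Finset.sum_congr rfl hinner, ← Finset.mul_sum, sum_linked P u.length hj h0
      fun p hp q hq r hr => matchPositions_gap hM hd hp hq hr, if_congr hw1 rfl rfl, if_neg hne]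
    split_ifs <;> ring
  -- Without a match at the start no prefix is linked, and deleting the first letter destroys no
  -- match: both sides vanish.
  · have hw1 : mch M u (w.drop 1) = 0 ↔ mch M u w = 0 := by
      rw [mch_drop_eq_zero, hw0, Finset.eq_empty_iff_forall_notMem]
      constructor
      · intro h q hq
        obtain rfl := Nat.lt_one_iff.1 (h q hq)
        exact h0 hq
      · exact fun h q hq => absurd hq (h q)
    rw [if_congr hw1 rfl rfl, sub_self, mul_zero]
    refine Finset.sum_eq_zero fun p hp => if_neg fun h => h0 ?_
    exact ((isLinked_take hM hu (Finset.mem_range.1 hp)).1 h).1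

end

end WordMatch

/-! ### The first-letter recursion and the resulting functional equation -/

namespace WordMatch

noncomputable section

/-- Nonempty sets are classified by their minimum, which heads the sorted list. -/
theorem sum_powerset_sort {N : Type*} [AddCommMonoid N] (F : List ℕ+ → N) (Q : Finset ℕ+) :
    ∑ S ∈ Q.powerset, F (S.sort (· ≤ ·)) =
      F [] + ∑ b ∈ Q, ∑ S ∈ (Q.filter (b < ·)).powerset, F (b :: S.sort (· ≤ ·)) := by
  classical
  induction Q using Finset.induction_on_min with
  | empty => simp
  | insert a s has ih =>
    have ha : a ∉ s := fun h => lt_irrefl _ (has a h)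
    rw [Finset.sum_powerset_insert ha, ih, Finset.sum_insert ha, add_assoc]
    congr 1
    rw [add_comm]
    congr 1
    · have h1 : (insert a s).filter (a < ·) = s := by
        ext b
        rw [Finset.mem_filter, Finset.mem_insert]
        constructor
        · rintro ⟨rfl | h, h'⟩
          · exact absurd h' (lt_irrefl _)
          · exact h
        · exact fun h => ⟨Or.inr h, has b h⟩
      rw [h1]
      refine Finset.sum_congr rfl fun S hS => ?_
      have hS' := Finset.mem_powerset.1 hS
      rw [Finset.sort_insert _ (fun b hb => (has b (hS' hb)).le) fun h => ha (hS' h)]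
    · refine Finset.sum_congr rfl fun b hb => ?_
      rw [Finset.filter_insert, if_neg (has b hb).le.not_gt]

theorem conv_sum_left {ι : Type*} (s : Finset ι) (f : ι → List ℕ+ → Polynomial ℤ)
    (g : List ℕ+ → Polynomial ℤ) (w : List ℕ+) :
    conv (fun v => ∑ i ∈ s, f i v) g w = ∑ i ∈ s, conv (f i) g w := by
  simp only [conv, Finset.sum_mul]
  rw [Finset.sum_comm]

theorem mul_sum_conv {ι : Type*} (s : Finset ι) (c : Polynomial ℤ) (f : List ℕ+ → Polynomial ℤ)
    (g : ι → List ℕ+ → Polynomial ℤ) (w : List ℕ+) :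
    c * ∑ i ∈ s, conv f (g i) w = conv f (fun v => c * ∑ i ∈ s, g i v) w := by
  simp only [conv, Finset.mul_sum]
  rw [Finset.sum_comm]
  refine Finset.sum_congr rfl fun i _ => Finset.sum_congr rfl fun k _ => ?_
  ring

theorem conv_congr_left {f f' g : List ℕ+ → Polynomial ℤ} {w : List ℕ+}
    (h : ∀ i, f (w.take i) = f' (w.take i)) : conv f g w = conv f' g w :=
  Finset.sum_congr rfl fun i _ => by rw [h]

variable {A : Set ℕ+} {M : List ℕ+ → List ℕ+ → Prop} {u : List ℕ+}

theorem conv_blockWt_eq_zero {b : ℕ+} {L w : List ℕ+} {g : List ℕ+ → Polynomial ℤ}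
    (h : w.head? ≠ some b) : conv (blockWt A M u (b :: L)) g w = 0 := by
  by_contra hne
  obtain ⟨v, v', rfl, hv, -⟩ := conv_ne_zero hne
  have h1 := (blockWt_ne_zero hv).1
  apply h
  rw [List.head?_append, h1]
  rfl

/-- The weight of what follows the initial run of a block, for the remaining letters `L` of the
block. -/
def restWt (A : Set ℕ+) (M : List ℕ+ → List ℕ+ → Prop) (u : List ℕ+)
    (g : List ℕ+ → Polynomial ℤ) (a : ℕ+) : List ℕ+ → List ℕ+ → Polynomial ℤ
  | [] => g
  | b :: L => conv (linkWt A M u a b) (conv (blockWt A M u (b :: L)) g)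

/-- Reading off one letter of the initial run either finishes the run or leaves a shorter run of the
same block, at the cost of a factor `1 - x`. -/
theorem conv_blockWt_cons (g : List ℕ+ → Polynomial ℤ) (a : ℕ+) (L w : List ℕ+) :
    conv (blockWt A M u (a :: L)) g (a :: w) =
      restWt A M u g a L w + (1 - Polynomial.X) * conv (blockWt A M u (a :: L)) g w := by
  have h : ∀ v, conv (blockWt A M u (a :: L)) g v = conv (runWt a) (restWt A M u g a L) v := by
    intro v
    cases L with
    | nil => rfl
    | cons b L =>
      rw [blockWt, conv_assoc]
      congr 1
      funext y
      rw [conv_assoc]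
      rfl
  rw [h, h, conv_runWt_cons, if_pos rfl]

theorem avoidWt_of_over {w : List ℕ+} (hw : IsWordOver A w) (hne : w ≠ []) :
    avoidWt A M u w = open Classical in
      if mch M u w = 0 then Polynomial.X ^ (des w + 1) else 0 := by
  simp [avoidWt, hw, hne]

/-- Decomposition of a word avoiding `u` according to the first step of its first block. -/
theorem avoidWt_cons (hM : ∀ v, M u v → red v = u) {d : ℕ} (hd : descents u = {d})
    (hlt : letter u 0 < letter u (u.length - 1)) (hwi : WeaklyIncreasingOverlap A u)
    (a : ℕ+) (w : List ℕ+) (hw : IsWordOver A (a :: w)) :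
    avoidWt A M u (a :: w) = Polynomial.X * avoidWt A M u w +
      ((∑ i ∈ Finset.range w.length, if a < letter w i then
        linkWt A M u a (letter w i) (w.take i) * avoidWt A M u (w.drop i) else 0) +
      (1 - Polynomial.X) * if w.head? = some a then avoidWt A M u w else 0) := by
  classical
  have hu : u ≠ [] := by
    rintro rfl
    simp [descents] at hd
  have hj : 2 ≤ u.length := by
    have : d ∈ descents u := by simp [hd]
    have := (mem_descents.1 this).1
    omega
  have hw' : IsWordOver A w := fun b hb => hw b (by simp [hb])
  have key := sum_isLinked_take (w := a :: w) hM hd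
  rw [List.length_cons, Finset.sum_range_succ', if_neg, add_zero] at key
  swap
  -- The dropped term is the one-letter prefix, too short to contain a match because `u` has a
  -- descent.
  · rw [isLinked_take hM hu (by simp)]
    rintro ⟨-, m, -, h, -⟩
    omega
  have hterm : ∀ i ∈ Finset.range w.length, (if a < letter w i then
      linkWt A M u a (letter w i) (w.take i) * avoidWt A M u (w.drop i) else 0) =
      (if i = 0 ∧ a < letter w i then (1 - Polynomial.X) * avoidWt A M u w else 0) +
      if IsLinked M u ((a :: w).take (i + 1 + 1)) then
        (-Polynomial.X) ^ mch M u ((a :: w).take (i + 1 + 1)) *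
        (if mch M u ((a :: w).drop (i + 1)) = 0 then
          (Polynomial.X : Polynomial ℤ) ^ (des ((a :: w).drop (i + 1)) + 1) else 0) else 0 := by
    intro i hi
    have hi' := Finset.mem_range.1 hi
    have e1 : (a :: w).take (i + 1 + 1) = a :: (w.take i ++ [letter w i]) := by
      rw [letter_eq hi', List.take_succ_cons, List.take_append_getElem]
    have hover : IsWordOver A ((a :: w).take (i + 1 + 1)) :=
      fun b hb => hw b (List.mem_of_mem_take hb)
    have e2 : avoidWt A M u (w.drop i) = if mch M u ((a :: w).drop (i + 1)) = 0 then
        (Polynomial.X : Polynomial ℤ) ^ (des ((a :: w).drop (i + 1)) + 1) else 0 := by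
      rw [List.drop_succ_cons, avoidWt_of_over]
      · exact fun b hb => hw' b (List.mem_of_mem_drop hb)
      · rw [Ne, List.drop_eq_nil_iff]
        omega
    -- This makes the condition `a < letter w i` harmless: no linked prefix is discarded by it. It
    -- then restricts only the `1 - x` part of the link weight.
    have e3 : IsLinked M u ((a :: w).take (i + 1 + 1)) → a < letter w i := by
      intro h
      have h1 := letter_lt_of_isLinked hM hu hlt hwi hover h
      rw [List.length_take, List.length_cons, min_eq_left (by omega), letter_take _ (by omega),
        letter_take _ (by omega)] at h1
      simpa [letter] using h1
    have e4 : convOne (w.take i) = if i = 0 then 1 else 0 := by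
      have : w ≠ [] := by
        rintro rfl
        simp at hi'
      simp [convOne, List.take_eq_nil_iff, this]
    rw [linkWt, ← e1, ← e2, e4, if_congr (and_iff_right hover) rfl rfl]
    by_cases h1 : a < letter w i
    · rw [if_pos h1, add_mul, ite_mul, zero_mul]
      by_cases h2 : i = 0
      · subst h2
        simp [h1]
      · simp [h2]
    · rw [if_neg h1, if_neg (fun h => h1 h.2), if_neg (fun h => h1 (e3 h)), add_zero]
  rw [Finset.sum_congr rfl hterm, Finset.sum_add_distrib, key, List.drop_one, List.tail_cons]
  have hmch : mch M u [] = 0 := by simp [mch, matchPositions]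
  cases w with
  | nil =>
    rw [avoidWt_of_over hw (by simp)]
    simp [avoidWt, IsWordOver, hmch, des]
    split_ifs <;> ring
  | cons b w =>
    have e : (∑ i ∈ Finset.range (b :: w).length, if i = 0 ∧ a < letter (b :: w) i then
        (1 - Polynomial.X) * avoidWt A M u (b :: w) else 0) =
        if a < b then (1 - Polynomial.X) * avoidWt A M u (b :: w) else 0 := by
      rw [Finset.sum_eq_single_of_mem 0 (by simp) fun i _ hi => if_neg fun h => hi h.1]
      simp [letter]
    rw [e, avoidWt_of_over hw (by simp), avoidWt_of_over hw' (by simp), des_cons_cons]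
    simp only [List.head?_cons, Option.some.injEq]
    -- At a descent the extra factor `x` is already present. At a rise the missing `(1 - x) *
    -- avoidWt w` comes from the empty link, and at a repeated letter from the run.
    rcases lt_trichotomy a b with h | h | h
    · rw [if_pos h, if_neg h.not_gt, if_neg h.ne']
      split_ifs <;> ring
    · subst h
      rw [if_neg (lt_irrefl _), if_neg (lt_irrefl _), if_pos rfl]
      split_ifs <;> ring
    · rw [if_neg h.not_gt, if_pos h, if_neg h.ne]
      split_ifs <;> ring

/-- Both sides obey the same first-letter recursion, so induction on length applies. Leaving `Q`
arbitrary lets the induction pass from the letters above `a` to those above a larger `b`, and from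
`w` to its suffixes. -/
theorem sum_conv_blockWt (hM : ∀ v, M u v → red v = u) {d : ℕ} (hd : descents u = {d})
    (hlt : letter u 0 < letter u (u.length - 1)) (hwi : WeaklyIncreasingOverlap A u) (n : ℕ)
    (a : ℕ+) (w : List ℕ+) (hn : w.length ≤ n) (hw : IsWordOver A (a :: w)) (Q : Finset ℕ+)
    (hQ : ∀ b ∈ Q, a < b) (hQ' : ∀ b ∈ w, a < b → b ∈ Q) :
    Polynomial.X * ∑ S ∈ Q.powerset,
      conv (blockWt A M u (a :: S.sort (· ≤ ·))) (avoidWt A M u) (a :: w) =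
      avoidWt A M u (a :: w) := by
  classical
  induction n using Nat.strong_induction_on generalizing a w Q with
  | _ n ih =>
    have hw' : IsWordOver A w := fun b hb => hw b (by simp [hb])
    -- The induction hypothesis, extended to words not starting with `b`, where every block weight
    -- with minimum `b` gives zero.
    have hrec : ∀ b v, v.length < w.length + 1 → IsWordOver A v → ∀ Q : Finset ℕ+,
        (∀ c ∈ Q, b < c) → (∀ c ∈ v, b < c → c ∈ Q) →
        Polynomial.X * ∑ S ∈ Q.powerset,
          conv (blockWt A M u (b :: S.sort (· ≤ ·))) (avoidWt A M u) v =
        if v.head? = some b then avoidWt A M u v else 0 := by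
      intro b v hv hvA Q hQ hQ'
      split_ifs with h
      · cases v with
        | nil => simp at h
        | cons c v =>
          obtain rfl : c = b := by simpa using h
          rw [List.length_cons] at hv
          exact ih v.length (by omega) c v le_rfl hvA Q hQ fun e he => hQ' e (by simp [he])
      · rw [Finset.sum_eq_zero fun S _ => conv_blockWt_eq_zero h, mul_zero]
    rw [avoidWt_cons hM hd hlt hwi a w hw]
    simp only [conv_blockWt_cons]
    rw [Finset.sum_add_distrib, sum_powerset_sort (fun L => restWt A M u _ a L w), mul_add, mul_add,
      add_assoc]
    congr 1
    congr 1
    · have h1 : ∀ b ∈ Q, Polynomial.X * ∑ S ∈ (Q.filter (b < ·)).powerset,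
          restWt A M u (avoidWt A M u) a (b :: S.sort (· ≤ ·)) w =
          ∑ i ∈ Finset.range (w.length + 1), linkWt A M u a b (w.take i) *
            if (w.drop i).head? = some b then avoidWt A M u (w.drop i) else 0 := by
        intro b hb
        simp only [restWt]
        rw [mul_sum_conv]
        refine Finset.sum_congr rfl fun i _ => ?_
        rw [← hrec b (w.drop i) (by rw [List.length_drop]; omega)
          (fun c hc => hw' c (List.mem_of_mem_drop hc)) (Q.filter (b < ·))
          (fun c hc => (Finset.mem_filter.1 hc).2)]
        intro c hc hbc
        exact Finset.mem_filter.2 ⟨hQ' c (List.mem_of_mem_drop hc) ((hQ b hb).trans hbc), hbc⟩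
      rw [Finset.mul_sum, Finset.sum_congr rfl h1, Finset.sum_comm, Finset.sum_range_succ]
      -- A cut at the very end leaves no letter `b` for the link to land on.
      have h2 : ∑ b ∈ Q, (linkWt A M u a b (w.take w.length) *
          if (w.drop w.length).head? = some b then avoidWt A M u (w.drop w.length) else 0) = 0 :=
        Finset.sum_eq_zero fun b _ => by simp
      rw [h2, add_zero]
      refine Finset.sum_congr rfl fun i hi => ?_
      have hi' := Finset.mem_range.1 hi
      have h3 : (w.drop i).head? = some (letter w i) := by
        rw [List.head?_drop, letter_eq hi', List.getElem?_eq_getElem hi']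
      have h4 : letter w i ∈ w := by
        rw [letter_eq hi']
        exact List.getElem_mem hi'
      simp only [h3, Option.some.injEq, mul_ite, mul_zero, Finset.sum_ite_eq]
      exact if_congr ⟨hQ _, hQ' _ h4⟩ rfl rfl
    · rw [← Finset.mul_sum, mul_left_comm, hrec a w (by omega) hw' Q hQ hQ']

/-- The first letter of a word is the minimum of its first block, so just one minimum survives and
`sum_conv_blockWt` applies. On words that leave the alphabet both sides vanish, since blocks and
avoiding words stay inside it. -/
theorem avoidWt_eq (hM : ∀ v, M u v → red v = u) {d : ℕ} (hd : descents u = {d})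
    (hlt : letter u 0 < letter u (u.length - 1)) (hwi : WeaklyIncreasingOverlap A u) :
    avoidWt A M u = fun w => convOne w +
      Polynomial.X * conv (totalBlockWt A M u) (avoidWt A M u) w := by
  classical
  funext w
  cases w with
  | nil => simp [conv_nil, convOne, avoidWt, IsWordOver, mch, matchPositions, totalBlockWt, blockWt]
  | cons a w =>
    rw [convOne, if_neg (by simp), zero_add]
    by_cases hw : IsWordOver A (a :: w)
    · set Q := (a :: w).toFinset with hQ
      have h1 : conv (totalBlockWt A M u) (avoidWt A M u) (a :: w) = ∑ S ∈ Q.powerset,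
          conv (blockWt A M u (S.sort (· ≤ ·))) (avoidWt A M u) (a :: w) := by
        rw [← conv_sum_left]
        refine conv_congr_left fun i => totalBlockWt_eq _ _ _ _ _ ?_ ?_
        · exact fun b hb _ => List.mem_toFinset.2 (List.mem_of_mem_take hb)
        · exact fun b hb => hw b (List.mem_toFinset.1 hb)
      rw [h1, sum_powerset_sort fun L => conv (blockWt A M u L) (avoidWt A M u) (a :: w),
        Finset.sum_eq_single_of_mem a (by simp [hQ])]
      · have h2 : conv (blockWt A M u []) (avoidWt A M u) (a :: w) = 0 := conv_zero_left _ _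
        rw [h2, zero_add]
        refine (sum_conv_blockWt hM hd hlt hwi w.length a w le_rfl hw _ ?_ ?_).symm
        · exact fun b hb => (Finset.mem_filter.1 hb).2
        · exact fun b hb hab => Finset.mem_filter.2 ⟨by simp [hQ, hb], hab⟩
      · intro b _ hb
        refine Finset.sum_eq_zero fun S _ => conv_blockWt_eq_zero ?_
        simpa using hb.symm
    · have h1 : conv (totalBlockWt A M u) (avoidWt A M u) (a :: w) = 0 := by
        by_contra h
        obtain ⟨v, v', he, hv, hv'⟩ := conv_ne_zero h
        have h2 := totalBlockWt_ne_zero _ _ _ hv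
        have h3 : IsWordOver A v' := by
          by_contra h3
          exact hv' (by simp [avoidWt, h3])
        refine hw fun b hb => ?_
        rw [← he, List.mem_append] at hb
        exact hb.elim (h2 b) (h3 b)
      rw [h1, mul_zero, avoidWt, if_neg fun h => hw h.1]

theorem avoidGF_mul (hM : ∀ v, M u v → red v = u) (hu : u ≠ []) (hdes : des u = 1)
    (hlt : u.head hu < u.getLast hu) (hwi : WeaklyIncreasingOverlap A u) :
    avoidGF A M u * (1 - toT x * wordSeries (totalBlockWt A M u)) = 1 := by
  rw [des_eq_card, Finset.card_eq_one] at hdes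
  obtain ⟨d, hd⟩ := hdes
  have hj := List.length_pos_iff.2 hu
  have hlt' : letter u 0 < letter u (u.length - 1) := by
    rw [letter_eq hj, letter_eq (by omega), ← List.head_eq_getElem hu, ← List.getLast_eq_getElem hu]
    exact hlt
  have h := congrArg wordSeries (avoidWt_eq hM hd hlt' hwi)
  rw [wordSeries_add, wordSeries_const_mul, wordSeries_convOne, ← wordSeries_mul, ← avoidGF_eq] at h
  have hx : toT (MvPowerSeries.C (Polynomial.X : Polynomial ℤ)) = toT x := rfl
  rw [hx] at h
  linear_combination h

end

end WordMatch

theorem mainTheorem2 (u : List ℕ+) (hu : u ≠ []) (hred : WordMatch.red u = u)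
    (hdes : WordMatch.des u = 1) (hlt : u.head hu < u.getLast hu) :
    (WordMatch.WeaklyIncreasingOverlap Set.univ u →
      WordMatch.avoidGF Set.univ WordMatch.IsMatch u *
          WordMatch.denomPP WordMatch.IsMatch u = 1 ∧
      WordMatch.avoidGF Set.univ WordMatch.IsExactMatch u *
          WordMatch.denomPP WordMatch.IsExactMatch u = 1) ∧
    ∀ k : ℕ+, WordMatch.IsWordOver (Set.Iic k) u →
      WordMatch.WeaklyIncreasingOverlap (Set.Iic k) u →
      WordMatch.avoidGF (Set.Iic k) WordMatch.IsMatch u *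
          WordMatch.denomK k WordMatch.IsMatch u = 1 ∧
      WordMatch.avoidGF (Set.Iic k) WordMatch.IsExactMatch u *
          WordMatch.denomK k WordMatch.IsExactMatch u = 1 := by
  have hM : ∀ v, WordMatch.IsMatch u v → WordMatch.red v = u := fun v h => h
  -- The argument uses only that a match reduces to `u`; for exact matches this is where `red u = u`
  -- is needed.
  have hE : ∀ v, WordMatch.IsExactMatch u v → WordMatch.red v = u := fun v h => by
    rw [show v = u from h, hred]
  refine ⟨fun hwi => ?_, fun k _ hwi => ?_⟩
  · rw [WordMatch.denomPP_eq, WordMatch.denomPP_eq]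
    exact ⟨WordMatch.avoidGF_mul hM hu hdes hlt hwi, WordMatch.avoidGF_mul hE hu hdes hlt hwi⟩
  · rw [WordMatch.denomK_eq, WordMatch.denomK_eq]
    exact ⟨WordMatch.avoidGF_mul hM hu hdes hlt hwi, WordMatch.avoidGF_mul hE hu hdes hlt hwi⟩
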